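/- Work in the Euclidean plane $\mathbb R^2$. A \emph{spring} is a segment $[a,b]$, $a\ne b$, with a coefficient $\lambda\in\mathbb R$; put $u=\frac{b-a}{|b-a|}$. It is \emph{compressed} if $\lambda>0$ and \emph{stretched} if $\lambda<0$; its boundary force is the vector measure $\lambda(\delta_b-\delta_a)u$, its mass is $|\lambda|\,|b-a|$, and its stress is the matrix measure $\lambda\,(u\otimes u)\,\mathcal H^1\llcorner[a,b]$. Boundary forces and masses of a finite system of springs are the sums of those of its members. A \emph{generalized spring system} $T$ is a compactly supported finite measure $T=A\mu$ with values in the symmetric $2\times2$ matrices ($\mu$ a finite positive Borel measure, $A$ integrable). Its mass is $\mathbb M(T)=\int |A|\,d\mu$, where $|A|$ is the sum of the absolute values of the eigenvalues of $A$. Its boundary force is the distribution $\varphi\mapsto\int\sum_{i,j}A_{ij}\,\partial_j\varphi_i\,d\mu$, for $\varphi\in C_c^\infty(\mathbb R^2;\mathbb R^2)$. Finite spring systems are included through the sums of their stresses. Let $\mathbf F=\sum_{i=1}^{l}F_i\,\delta_{M_i}$ be a finite system of pointed forces in equilibrium, that is, $\sum_iF_i=0$ and $\sum_iF_i\wedge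 M_i=0$. Let $T$ be a minimizer for $\mathbf F$: a generalized spring system with boundary force $\mathbf F$ whose mass is at most the mass of every finite spring system with boundary force $\mathbf F$. Let $p\notin\{M_1,\dots,M_l\}$ be a point at which finitely many springs of $T$ meet: there are finitely many springs, each containing $p$ (as an endpoint or as an interior point), any two of them meeting only at $p$, such that in some disc around $p$ the measure $T$ is the sum of their stresses. Then: 1. the boundary forces of these springs at $p$ sum to zero; 2. the angle between any stretched spring and any compressed spring among them is $90^\circ$. -/

import Mathlib

open MeasureTheory
open scoped ContDiff

noncomputable section

/-- The Euclidean plane. -/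
abbrev Plane : Type := EuclideanSpace ℝ (Fin 2)

/-- A spring: a nondegenerate segment `[a, b]` with a coefficient `coeff`, that is, the stressed
segment `(coeff • u ⊗ u) ⊗ [a, b]`, where `u` is the unit vector from `a` to `b`. -/
structure Spring where
  a : Plane
  b : Plane
  ne : a ≠ b
  coeff : ℝ

namespace Spring

/-- The unit vector from `a` to `b`. -/
def dir (s : Spring) : Plane := ‖s.b - s.a‖⁻¹ • (s.b - s.a)

/-- The points of the spring. -/
def carrier (s : Spring) : Set Plane := segment ℝ s.a s.b

/-- A compressed spring pushes outward on its endpoints. -/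
def IsCompressed (s : Spring) : Prop := 0 < s.coeff

/-- A stretched spring pulls inward on its endpoints. -/
def IsStretched (s : Spring) : Prop := s.coeff < 0

open Classical in
/-- The force of the spring at the point `x`: this is `coeff • (δ_b - δ_a) u` at `x`, so it is
zero unless `x` is an endpoint. -/
def boundaryForce (s : Spring) (x : Plane) : Plane :=
  (if x = s.b then s.coeff • s.dir else 0) - (if x = s.a then s.coeff • s.dir else 0)

/-- The `(i, j)` entry of the stress carried by the spring in a set `S`: the integral of the matrix
`coeff • u ⊗ u` over `S ∩ [a, b]` with respect to length. -/
def stressOn (s : Spring) (S : Set Plane) (i j : Fin 2) : ℝ :=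
  s.coeff * s.dir i * s.dir j * (Measure.hausdorffMeasure 1 (S ∩ s.carrier)).toReal

end Spring

/-- The mass of a finite spring system: coefficient (in absolute value) times length, summed. -/
def springMass {n : ℕ} (P : Fin n → Spring) : ℝ :=
  ∑ k, |(P k).coeff| * dist (P k).a (P k).b

/-- A system of pointed forces `F i` applied at `M i` is in equilibrium: the net force and the net
torque vanish. -/
def IsEquilibrium {ι : Type*} [Fintype ι] (M F : ι → Plane) : Prop :=
  ∑ i, F i = 0 ∧ ∑ i, (F i 0 * M i 1 - F i 1 * M i 0) = 0

open Classical in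
/-- The boundary of the finite spring system `P` is the system of forces `∑ i, F i δ_{M i}`. -/
def SpringBoundaryEq {n : ℕ} {ι : Type*} [Fintype ι] (P : Fin n → Spring) (M F : ι → Plane) :
    Prop :=
  ∀ x : Plane, ∑ k, (P k).boundaryForce x = ∑ i, if M i = x then F i else 0

/-- The cost of a symmetric matrix: the sum of the absolute values of its eigenvalues. -/
def matrixCost {A : Matrix (Fin 2) (Fin 2) ℝ} (hA : A.IsHermitian) : ℝ :=
  ∑ i, |hA.eigenvalues i|

/-- A generalized spring system: a compactly supported measure with values in the symmetric
`2 × 2` matrices, in the polar form `density • base`.  A finite spring system is the case of the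
sum of the matrices `coeff • u ⊗ u` times the length measures of its segments; limits of finite
systems, in which springs smear out, are of this form too. -/
structure StressMeasure where
  base : Measure Plane
  finite : IsFiniteMeasure base
  compactSupport : ∃ K : Set Plane, IsCompact K ∧ base Kᶜ = 0
  density : Plane → Matrix (Fin 2) (Fin 2) ℝ
  symmetric : ∀ x, (density x).IsHermitian
  integrable : ∀ i j, Integrable (fun x => density x i j) base

namespace StressMeasure

/-- The mass of a generalized spring system. -/
def mass (T : StressMeasure) : ℝ := ∫ x, matrixCost (T.symmetric x) ∂T.base

/-- The boundary of `T` is the system of forces `∑ i, F i δ_{M i}`, in the sense of distributions.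
For a single spring, `∫ ⟨T, Dφ⟩ = coeff * ⟪u, φ b - φ a⟫`. -/
def BoundaryEq (T : StressMeasure) {ι : Type*} [Fintype ι] (M F : ι → Plane) : Prop :=
  ∀ φ : Plane → Plane, ContDiff ℝ ∞ φ → HasCompactSupport φ →
    ∫ x, ∑ i, ∑ j, T.density x i j * (fderiv ℝ φ x (EuclideanSpace.single j 1)) i ∂T.base
      = ∑ k, inner ℝ (F k) (φ (M k))

/-- `T` is a minimizer for the forces `∑ i, F i δ_{M i}`: it has this boundary, and its mass does
not exceed that of any finite spring system with this boundary. -/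
def IsMinimizer (T : StressMeasure) {ι : Type*} [Fintype ι] (M F : ι → Plane) : Prop :=
  T.BoundaryEq M F ∧
    ∀ (n : ℕ) (P : Fin n → Spring), SpringBoundaryEq P M F → T.mass ≤ springMass P

/-- Near `p`, the system `T` consists of the finitely many springs `s k`, which all contain `p`
(as an endpoint or in the interior) and meet each other only at `p`. -/
def IsSpringsNear (T : StressMeasure) (p : Plane) {κ : Type*} [Fintype κ] (s : κ → Spring) :
    Prop :=
  (∀ k, p ∈ (s k).carrier) ∧
  (∀ k l, k ≠ l → (s k).carrier ∩ (s l).carrier = {p}) ∧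
  ∃ r : ℝ, 0 < r ∧ ∀ S : Set Plane, MeasurableSet S → S ⊆ Metric.ball p r →
    ∀ i j, ∫ x in S, T.density x i j ∂T.base = ∑ k, (s k).stressOn S i j

end StressMeasure

end

/-! The proof is by duality. A dual field is a displacement field `φ` whose strain `⟪φ x - φ y, x -
y⟫ / ‖x - y‖ ^ 2` lies in `[-1, 1]`; its work `∑ ⟪F i, φ (M i)⟫` is at most the mass of any spring
system with boundary `F`. Hahn–Banach on the space of finite combinations of bars yields a `φ` whose
work is at least the mass of `T` (`exists_dualField`). Equality must then hold on every piece of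
`T`, so `φ` has strain `1` along the compressed springs at `p` and `-1` along the stretched ones
(`le_coeff_mul_inner`). As `φ` is only continuous and `T` only a measure, this comparison goes
through mollifications of `φ`.

Extremal strain is rigid: it makes `φ` affine at dyadic points of the segment (`midpoint_eq`,
`dyadic`). Comparing a point near `p` on one spring with a far point on the other, and conversely,
then excludes acute angles between a compressed and a stretched ray from `p` (`inner_nonpos`).

The balance of forces at `p` comes from testing the boundary equation with a bump around `p`. It
upgrades "not acute" to "right": the compressed forces at `p` sum to minus the stretched ones, while
every mixed inner product of forces is nonnegative, so all of them vanish. A spring with `p` in its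
interior offers two opposite rays, and for it "not acute" already suffices. -/

/-! ### Rigidity of dual fields along segments of extremal strain -/

/-- The admissible displacement fields of the dual problem: those of strain at most one. -/
def IsDualField {E : Type*} [NormedAddCommGroup E] [InnerProductSpace ℝ E] (φ : E → E) : Prop :=
  ∀ x y, |inner ℝ (φ x - φ y) (x - y)| ≤ ‖x - y‖ ^ 2

namespace IsDualField

variable {E : Type*} [NormedAddCommGroup E] [InnerProductSpace ℝ E] {φ : E → E}

theorem neg (hφ : IsDualField φ) : IsDualField (fun x => -φ x) := by
  intro x y
  have h := hφ x y
  rwa [← abs_neg, ← inner_neg_left, neg_sub, ← neg_sub_neg] at h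

/-- A dual field of maximal strain on both halves of a segment is affine at its midpoint. -/
theorem midpoint_eq (hφ : IsDualField φ) {x d : E}
    (h₁ : inner ℝ (φ (x + d) - φ x) d = ‖d‖ ^ 2) (h₂ : inner ℝ (φ x - φ (x - d)) d = ‖d‖ ^ 2) :
    φ (x + d) + φ (x - d) = (2 : ℝ) • φ x := by
  -- The defect `v` is orthogonal to `d`. Moving from `x` by `h • v` and testing against `x + d`, `x
  -- - d` and `x` makes all terms of order zero in `h` cancel: a linear term in `h` is bounded by a
  -- quadratic one, which forces `v = 0`.
  set v := (2 : ℝ) • φ x - φ (x + d) - φ (x - d) with hv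
  have hvd : inner ℝ v d = 0 := by
    have : v = (φ x - φ (x - d)) - (φ (x + d) - φ x) := by rw [hv, two_smul]; abel
    rw [this, inner_sub_left, h₁, h₂, sub_self]
  have key : ∀ h : ℝ, h * ‖v‖ ^ 2 ≤ 4 * h ^ 2 * ‖v‖ ^ 2 := by
    intro h
    have a₁ := (abs_le.1 (hφ (x + h • v) (x + d))).2
    have a₂ := (abs_le.1 (hφ (x + h • v) (x - d))).2
    have a₃ := (abs_le.1 (hφ (x + h • v) x)).1
    have e₁ : x + h • v - (x + d) = h • v - d := by abel
    have e₂ : x + h • v - (x - d) = h • v + d := by abel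
    have e₃ : x + h • v - x = h • v := by abel
    rw [e₁, norm_sub_sq_real] at a₁
    rw [e₂, norm_add_sq_real] at a₂
    rw [e₃] at a₃
    simp only [inner_sub_left, inner_sub_right, inner_add_right, inner_smul_right,
      inner_smul_left, norm_smul, mul_pow, Real.norm_eq_abs, sq_abs, hvd,
      RCLike.conj_to_real] at a₁ a₂ a₃ h₁ h₂
    have hvv : ‖v‖ ^ 2 = 2 * inner ℝ (φ x) v - inner ℝ (φ (x + d)) v - inner ℝ (φ (x - d)) v := by
      rw [← real_inner_self_eq_norm_sq]
      nth_rewrite 1 [hv]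
      simp only [inner_sub_left, inner_smul_left, RCLike.conj_to_real]
    rw [hvv] at a₁ a₂ a₃ ⊢
    nlinarith
  have h0 : ‖v‖ ^ 2 ≤ 0 := by
    have := key (1 / 8)
    nlinarith
  have h1 : v = 0 := by
    have : ‖v‖ = 0 := by nlinarith [norm_nonneg v]
    exact norm_eq_zero.1 this
  rw [hv] at h1
  rw [← sub_eq_zero, ← neg_eq_zero, ← h1]
  abel

/-- Dyadic linearity along a segment of maximal strain. -/
theorem dyadic (hφ : IsDualField φ) {p d : E}
    (h : ∀ t ∈ Set.Icc (0 : ℝ) 1, inner ℝ (φ (p + t • d) - φ p) d = t * ‖d‖ ^ 2) (n : ℕ) :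
    φ (p + ((1 / 2 : ℝ) ^ n) • d) - φ p = ((1 / 2 : ℝ) ^ n) • (φ (p + d) - φ p) := by
  induction n with
  | zero => simp
  | succ n ih =>
    set t : ℝ := (1 / 2 : ℝ) ^ n with ht
    have ht0 : 0 < t := by positivity
    have ht1 : t ≤ 1 := pow_le_one₀ (by norm_num) (by norm_num)
    have e : (1 / 2 : ℝ) ^ (n + 1) = t / 2 := by rw [pow_succ, ← ht]; ring
    have hA := h t ⟨ht0.le, ht1⟩
    have hB := h (t / 2) ⟨by positivity, by linarith⟩
    have ex : p + (t / 2) • d + (t / 2) • d = p + t • d := by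
      rw [add_assoc, ← add_smul]; congr 2; ring
    have m := hφ.midpoint_eq (x := p + (t / 2) • d) (d := (t / 2) • d)
      (by
        rw [ex, inner_smul_right, norm_smul, Real.norm_of_nonneg (by positivity)]
        have : φ (p + t • d) - φ (p + (t / 2) • d)
          = (φ (p + t • d) - φ p) - (φ (p + (t / 2) • d) - φ p) := by abel
        rw [this, inner_sub_left, hA, hB]; ring)
      (by
        rw [add_sub_cancel_right, inner_smul_right, norm_smul, Real.norm_of_nonneg (by positivity),
          hB]; ring)
    rw [ex, add_sub_cancel_right] at m
    rw [e]
    have m' : (2 : ℝ) • (φ (p + (t / 2) • d) - φ p) = t • (φ (p + d) - φ p) := by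
      rw [← ih, smul_sub, ← m, two_smul]; abel
    have : φ (p + (t / 2) • d) - φ p = (2 : ℝ)⁻¹ • ((2 : ℝ) • (φ (p + (t / 2) • d) - φ p)) := by
      rw [smul_smul]; norm_num
    rw [this, m', smul_smul]
    congr 1; ring

/-- Segments issuing from one point, of extremal strains of opposite signs, do not meet at an acute
angle. -/
theorem inner_nonpos (hφ : IsDualField φ) {p d e : E}
    (hd : ∀ t ∈ Set.Icc (0 : ℝ) 1, inner ℝ (φ (p + t • d) - φ p) d = t * ‖d‖ ^ 2)
    (he : ∀ t ∈ Set.Icc (0 : ℝ) 1, inner ℝ (φ (p + t • e) - φ p) e = -(t * ‖e‖ ^ 2)) :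
    inner ℝ d e ≤ 0 := by
  have Dd := hφ.dyadic hd
  have De : ∀ n : ℕ, φ (p + ((1 / 2 : ℝ) ^ n) • e) - φ p
      = ((1 / 2 : ℝ) ^ n) • (φ (p + e) - φ p) := by
    intro n
    have := hφ.neg.dyadic (p := p) (d := e) (by
      intro t ht
      have := he t ht
      rw [neg_sub_neg, ← neg_sub, inner_neg_left, this, neg_neg]) n
    rw [neg_sub_neg, neg_sub_neg] at this
    rw [← neg_sub, this, ← smul_neg, neg_sub]
  have hd1 := hd 1 (by simp)
  have he1 := he 1 (by simp)
  rw [one_smul] at hd1 he1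
  set X := φ (p + d) - φ p with hX
  set Y := φ (p + e) - φ p with hY
  have key : ∀ n : ℕ, 2 * inner ℝ d e ≤ (1 / 2 : ℝ) ^ n * (‖d‖ ^ 2 + ‖e‖ ^ 2) := by
    intro n
    have Dn := Dd n
    have En := De n
    set τ : ℝ := (1 / 2 : ℝ) ^ n with hτ
    have hτ0 : 0 < τ := by positivity
    -- The unknown cross term `⟪X, e⟫ + ⟪Y, d⟫` enters the two inequalities with opposite signs, so
    -- adding them eliminates it and leaves `⟪d, e⟫` against an error of order `τ`.
    have a₁ := (abs_le.1 (hφ (p + τ • d) (p + e))).1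
    have a₂ := (abs_le.1 (hφ (p + d) (p + τ • e))).2
    have e₁ : φ (p + τ • d) - φ (p + e) = τ • X - Y := by rw [← Dn, hY]; abel
    have e₂ : φ (p + d) - φ (p + τ • e) = X - τ • Y := by rw [← En, hX]; abel
    rw [e₁, add_sub_add_left_eq_sub, norm_sub_sq_real] at a₁
    rw [e₂, add_sub_add_left_eq_sub, norm_sub_sq_real] at a₂
    simp only [inner_sub_left, inner_sub_right, inner_smul_right,
      inner_smul_left, norm_smul, mul_pow, Real.norm_eq_abs, sq_abs,
      RCLike.conj_to_real] at a₁ a₂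
    rw [hd1, he1] at a₁ a₂
    have : 0 ≤ τ * (τ * (‖d‖ ^ 2 + ‖e‖ ^ 2) - 2 * inner ℝ d e) := by nlinarith
    have := nonneg_of_mul_nonneg_right this hτ0
    linarith
  have lim : Filter.Tendsto (fun n : ℕ => (1 / 2 : ℝ) ^ n * (‖d‖ ^ 2 + ‖e‖ ^ 2)) Filter.atTop
      (nhds (0 * (‖d‖ ^ 2 + ‖e‖ ^ 2))) :=
    (tendsto_pow_atTop_nhds_zero_of_lt_one (by norm_num) (by norm_num)).mul_const _
  have := ge_of_tendsto' lim key
  linarith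

end IsDualField

/-! ### Local boundedness and continuity of dual fields -/

namespace IsDualField

/-- Testing against `0` and against a basis vector `e` controls `⟪φ z, z⟫` and `⟪φ z, z - e⟫`; their
difference is a coordinate of `φ z`. -/
theorem exists_bound {φ : Plane → Plane} (hφ : IsDualField φ) (ρ : ℝ) :
    ∃ R : ℝ, ∀ z, ‖z‖ ≤ ρ → ‖φ z‖ ≤ R := by
  have coord : ∀ i : Fin 2, ∃ R : ℝ, ∀ z, ‖z‖ ≤ ρ → |φ z i| ≤ R := by
    intro i
    set e : Plane := EuclideanSpace.single i 1 with he
    have ne : ‖e‖ = 1 := by simp [he]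
    refine ⟨ρ ^ 2 + ‖φ 0‖ * ρ + (ρ + 1) ^ 2 + ‖φ e‖ * (ρ + 1), fun z hz => ?_⟩
    have h₀ := abs_le.1 (hφ z 0)
    have h₁ := abs_le.1 (hφ z e)
    rw [sub_zero, inner_sub_left] at h₀
    rw [inner_sub_left] at h₁
    have hzi : φ z i = inner ℝ (φ z) z - inner ℝ (φ z) (z - e) := by
      rw [← inner_sub_right, sub_sub_cancel, he, EuclideanSpace.inner_single_right]; simp
    have c₀ := abs_le.1 (abs_real_inner_le_norm (φ 0) z)
    have c₁ := abs_le.1 (abs_real_inner_le_norm (φ e) (z - e))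
    have hze : ‖z - e‖ ≤ ρ + 1 := (norm_sub_le _ _).trans (by rw [ne]; linarith)
    have hρ : 0 ≤ ρ := (norm_nonneg z).trans hz
    have s₀ : ‖z‖ ^ 2 ≤ ρ ^ 2 := by gcongr
    have s₁ : ‖z - e‖ ^ 2 ≤ (ρ + 1) ^ 2 := by gcongr
    have s₂ : ‖φ 0‖ * ‖z‖ ≤ ‖φ 0‖ * ρ := by gcongr
    have s₃ : ‖φ e‖ * ‖z - e‖ ≤ ‖φ e‖ * (ρ + 1) := by gcongr
    rw [hzi, abs_le]
    constructor <;> linarith [h₀.1, h₀.2, h₁.1, h₁.2, c₀.1, c₀.2, c₁.1, c₁.2]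
  obtain ⟨R₀, h₀⟩ := coord 0
  obtain ⟨R₁, h₁⟩ := coord 1
  refine ⟨R₀ + R₁, fun z hz => ?_⟩
  have a₀ := h₀ z hz
  have a₁ := h₁ z hz
  rw [EuclideanSpace.norm_eq, Fin.sum_univ_two]
  apply Real.sqrt_le_iff.2
  simp only [Real.norm_eq_abs]
  constructor
  · linarith [abs_nonneg (φ z 0), abs_nonneg (φ z 1)]
  · nlinarith [abs_nonneg (φ z 0), abs_nonneg (φ z 1)]

theorem continuous {φ : Plane → Plane} (hφ : IsDualField φ) : Continuous φ := by
  rw [continuous_iff_continuousAt]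
  intro y
  obtain ⟨R₁, hR₁⟩ := hφ.exists_bound (‖y‖ + 1)
  obtain ⟨R₂, hR₂⟩ := hφ.exists_bound (‖y‖ + 1 + R₁)
  have hy₁ : ‖φ y‖ ≤ R₁ := hR₁ y (by linarith)
  have hR₁0 : 0 ≤ R₁ := (norm_nonneg _).trans hy₁
  have hy₂ : ‖φ y‖ ≤ R₂ := hR₂ y (by linarith)
  have key : ∀ x, ‖x - y‖ ≤ 1 →
      ‖φ x - φ y‖ ^ 2 ≤ 12 * (2 * ‖x - y‖ ^ 2 + 2 * R₂ * ‖x - y‖) := by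
    intro x hx
    set v := φ x - φ y with hv
    set D := x - y with hD
    -- A third point displaced along the increment `v`: comparing it with `x` and with `y` isolates
    -- `‖v‖ ^ 2`. With the factor `1 / 6` the quadratic errors can be absorbed, giving a local
    -- Hölder estimate of exponent `1 / 2`.
    set z := x + (1 / 6 : ℝ) • v with hz
    have hxn : ‖x‖ ≤ ‖y‖ + 1 := by
      have : x = y + D := by rw [hD]; abel
      rw [this]; exact (norm_add_le _ _).trans (by linarith)
    have hvn : ‖v‖ ≤ R₁ + R₁ := (norm_sub_le _ _).trans (add_le_add (hR₁ x hxn) hy₁)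
    have hzn : ‖z‖ ≤ ‖y‖ + 1 + R₁ := by
      refine (norm_add_le _ _).trans ?_
      rw [norm_smul, Real.norm_of_nonneg (by norm_num)]
      linarith
    have hzb := hR₂ z hzn
    have a₁ := (abs_le.1 (hφ z y)).2
    have a₂ := (abs_le.1 (hφ z x)).1
    have e₁ : z - y = (1 / 6 : ℝ) • v + D := by rw [hz, hD]; abel
    have e₂ : z - x = (1 / 6 : ℝ) • v := by rw [hz]; abel
    have e₃ : φ z - φ y = (φ z - φ x) + v := by rw [hv]; abel
    have c := (abs_le.1 (abs_real_inner_le_norm (φ z - φ y) D)).1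
    have c' : ‖φ z - φ y‖ * ‖D‖ ≤ (R₂ + R₂) * ‖D‖ := by
      gcongr
      exact (norm_sub_le _ _).trans (add_le_add hzb hy₂)
    have hc := (abs_le.1 (abs_real_inner_le_norm v D)).2
    rw [e₁, inner_add_right, norm_add_sq_real] at a₁
    rw [e₂] at a₂
    rw [e₃, inner_smul_right, inner_add_left, real_inner_self_eq_norm_sq] at a₁
    rw [inner_smul_right] at a₂
    rw [e₃] at c
    rw [inner_smul_left, norm_smul, mul_pow] at a₁
    rw [norm_smul, mul_pow] at a₂
    simp only [RCLike.conj_to_real, Real.norm_eq_abs, sq_abs] at a₁ a₂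
    rw [e₃] at c'
    nlinarith [sq_nonneg (‖v‖ - 6 * ‖D‖)]
  rw [ContinuousAt, tendsto_iff_norm_sub_tendsto_zero]
  have lim : Filter.Tendsto
      (fun x => Real.sqrt (12 * (2 * ‖x - y‖ ^ 2 + 2 * R₂ * ‖x - y‖))) (nhds y) (nhds 0) := by
    have : Continuous fun x : Plane =>
        Real.sqrt (12 * (2 * ‖x - y‖ ^ 2 + 2 * R₂ * ‖x - y‖)) := by fun_prop
    have h := this.tendsto y
    simpa using h
  refine tendsto_of_tendsto_of_tendsto_of_le_of_le' tendsto_const_nhds lim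
    (Filter.Eventually.of_forall fun _ => norm_nonneg _) ?_
  filter_upwards [Metric.closedBall_mem_nhds y one_pos] with x hx
  exact Real.le_sqrt_of_sq_le (key x (by simpa [dist_eq_norm] using hx))

end IsDualField

/-! ### Duality between spring systems and dual fields -/

/-- Fields of zero strain do no work against forces in equilibrium. -/
theorem IsEquilibrium.sum_inner_eq_zero {ι : Type*} [Fintype ι] {M F : ι → Plane}
    (hF : IsEquilibrium M F) {φ : Plane → Plane}
    (hφ : ∀ x y, inner ℝ (φ x - φ y) (x - y) = 0) : ∑ i, inner ℝ (F i) (φ (M i)) = 0 := by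
  set e : Fin 2 → Plane := fun i => EuclideanSpace.single i 1
  have skew : ∀ x y, inner ℝ (φ x - φ 0) y + inner ℝ (φ y - φ 0) x = 0 := by
    intro x y
    have h₁ := hφ x y
    have h₂ := hφ x 0
    have h₃ := hφ y 0
    simp only [inner_sub_left, inner_sub_right, inner_zero_right] at *
    linarith
  -- Skew-symmetry against the basis vectors makes `φ` affine with skew linear part, an
  -- infinitesimal rigid motion; its work involves only net force and torque.
  have coord : ∀ x i, φ x i = φ 0 i - ((φ (e i) 0 - φ 0 0) * x 0 + (φ (e i) 1 - φ 0 1) * x 1) := by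
    intro x i
    have := skew x (e i)
    rw [EuclideanSpace.inner_single_right] at this
    simp [PiLp.inner_apply, Fin.sum_univ_two] at this
    linarith
  have h00 := coord (e 0) 0
  have h11 := coord (e 1) 1
  have h01 := coord (e 0) 1
  simp [e] at h00 h11 h01
  obtain ⟨hF₁, hF₂⟩ := hF
  have f0 : ∑ i, F i 0 = 0 := by simpa using congrArg (fun v : Plane => v 0) hF₁
  have f1 : ∑ i, F i 1 = 0 := by simpa using congrArg (fun v : Plane => v 1) hF₁
  have : ∀ i, inner ℝ (F i) (φ (M i)) = φ 0 0 * F i 0 + φ 0 1 * F i 1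
      + (φ (e 1) 0 - φ 0 0) * (F i 0 * M i 1 - F i 1 * M i 0) := by
    intro i
    simp only [PiLp.inner_apply, Fin.sum_univ_two, RCLike.inner_apply, RCLike.conj_to_real]
    rw [coord (M i) 0, coord (M i) 1]
    have a : φ (e 0) 0 = φ 0 0 := by simp only [e]; linarith
    have b : φ (e 1) 1 = φ 0 1 := by simp only [e]; linarith
    have c : φ (e 0) 1 = φ 0 1 - (φ (e 1) 0 - φ 0 0) := by simp only [e]; linarith
    rw [a, b, c]
    ring
  rw [Finset.sum_congr rfl fun i _ => this i]
  simp only [Finset.sum_add_distrib, ← Finset.mul_sum, f0, f1, hF₂]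
  ring

noncomputable section

/-- Nondegenerate segments, as ordered pairs of endpoints. -/
abbrev Bar : Type := {x : Plane × Plane // x.1 ≠ x.2}

namespace Bar

/-- The spring of coefficient `r` on a bar. -/
def toSpring (x : Bar) (r : ℝ) : Spring := ⟨x.1.1, x.1.2, x.2, r⟩

/-- The boundary force of a unit spring on a bar. -/
def force (x : Bar) : Plane →₀ Plane :=
  Finsupp.single x.1.2 (x.toSpring 1).dir - Finsupp.single x.1.1 (x.toSpring 1).dir

theorem boundaryForce_toSpring (x : Bar) (r : ℝ) (z : Plane) :
    (x.toSpring r).boundaryForce z = r • x.force z := by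
  classical
  simp only [Spring.boundaryForce, force, Finsupp.sub_apply, Finsupp.single_apply, smul_sub,
    smul_ite, smul_zero, eq_comm (a := z)]
  rfl

/-- The mass of a finite combination of bars. -/
def weight (w : Bar →₀ ℝ) : ℝ := w.sum fun x r => |r| * dist x.1.1 x.1.2

theorem weight_eq {w : Bar →₀ ℝ} {s : Finset Bar} (h : w.support ⊆ s) :
    weight w = ∑ x ∈ s, |w x| * dist x.1.1 x.1.2 :=
  Finsupp.sum_of_support_subset _ h _ (by simp)

theorem weight_single (x : Bar) (r : ℝ) :
    weight (Finsupp.single x r) = |r| * dist x.1.1 x.1.2 :=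
  Finsupp.sum_single_index (by simp)

theorem weight_nonneg (w : Bar →₀ ℝ) : 0 ≤ weight w :=
  Finset.sum_nonneg fun _ _ => by positivity

theorem weight_smul (c : ℝ) (w : Bar →₀ ℝ) : weight (c • w) = |c| * weight w := by
  rw [weight_eq Finsupp.support_smul, weight_eq subset_rfl, Finset.mul_sum]
  refine Finset.sum_congr rfl fun x _ => ?_
  rw [Finsupp.smul_apply, smul_eq_mul, abs_mul, mul_assoc]

theorem weight_add (v w : Bar →₀ ℝ) : weight (v + w) ≤ weight v + weight w := by
  classical
  rw [weight_eq Finsupp.support_add, weight_eq (s := v.support ∪ w.support)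
    Finset.subset_union_left, weight_eq (s := v.support ∪ w.support) Finset.subset_union_right,
    ← Finset.sum_add_distrib]
  refine Finset.sum_le_sum fun x _ => ?_
  rw [← add_mul, Finsupp.add_apply]
  gcongr
  exact abs_add_le _ _

/-- The boundary force of a finite combination of bars. -/
abbrev boundary : (Bar →₀ ℝ) →ₗ[ℝ] (Plane →₀ Plane) := Finsupp.linearCombination ℝ force

theorem exists_springs (w : Bar →₀ ℝ) : ∃ (n : ℕ) (P : Fin n → Spring),
    springMass P = weight w ∧ ∀ z, ∑ k, (P k).boundaryForce z = boundary w z := by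
  let e := w.support.equivFin.symm
  refine ⟨_, fun k => (e k).1.toSpring (w (e k)), ?_, fun z => ?_⟩
  · rw [springMass, weight, Finsupp.sum,
      ← Finset.sum_coe_sort w.support fun x => |w x| * dist x.1.1 x.1.2]
    exact e.sum_comp fun x : w.support => |w x| * dist x.1.1.1 x.1.1.2
  · simp only [boundaryForce_toSpring]
    rw [e.sum_comp fun x : w.support => w x • x.1.force z, boundary,
      Finsupp.linearCombination_apply, Finsupp.sum, Finsupp.finsetSum_apply]
    exact Finset.sum_coe_sort w.support fun x => w x • x.force z

end Bar

/-- The vector field that represents a functional on finitely supported forces. -/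
def fieldOf (L : (Plane →₀ Plane) →ₗ[ℝ] ℝ) (x : Plane) : Plane :=
  (InnerProductSpace.toDual ℝ Plane).symm (LinearMap.toContinuousLinearMap (L ∘ₗ Finsupp.lsingle x))

theorem inner_fieldOf (L : (Plane →₀ Plane) →ₗ[ℝ] ℝ) (x v : Plane) :
    inner ℝ (fieldOf L x) v = L (Finsupp.single x v) := by
  rw [fieldOf, InnerProductSpace.toDual_symm_apply]
  rfl

theorem map_force_eq (L : (Plane →₀ Plane) →ₗ[ℝ] ℝ) (x : Bar) :
    L x.force = inner ℝ (fieldOf L x.1.2 - fieldOf L x.1.1) (x.toSpring 1).dir := by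
  rw [Bar.force, map_sub, inner_sub_left, inner_fieldOf, inner_fieldOf]

theorem inner_fieldOf_sub (L : (Plane →₀ Plane) →ₗ[ℝ] ℝ) (x : Bar) :
    inner ℝ (fieldOf L x.1.2 - fieldOf L x.1.1) (x.1.2 - x.1.1)
      = ‖x.1.2 - x.1.1‖ * L x.force := by
  have : ‖x.1.2 - x.1.1‖ ≠ 0 := norm_ne_zero_iff.2 (sub_ne_zero.2 x.2.symm)
  rw [map_force_eq, Spring.dir, inner_smul_right]
  simp only [Bar.toSpring]
  field_simp

/-- Every system of forces in equilibrium has an optimal dual field. -/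
theorem exists_dualField {ι : Type*} [Fintype ι] {M F : ι → Plane} (hF : IsEquilibrium M F)
    {m : ℝ} (hm₀ : 0 ≤ m)
    (hm : ∀ (n : ℕ) (P : Fin n → Spring), SpringBoundaryEq P M F → m ≤ springMass P) :
    ∃ φ : Plane → Plane, IsDualField φ ∧ m ≤ ∑ i, inner ℝ (F i) (φ (M i)) := by
  classical
  set G : Plane →₀ Plane := ∑ i, Finsupp.single (M i) (F i) with hG
  have hGL : ∀ L : (Plane →₀ Plane) →ₗ[ℝ] ℝ, L G = ∑ i, inner ℝ (F i) (fieldOf L (M i)) := by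
    intro L
    rw [hG, map_sum]
    refine Finset.sum_congr rfl fun i _ => ?_
    rw [real_inner_comm, inner_fieldOf]
  have hw : ∀ w, Bar.boundary w = G → m ≤ Bar.weight w := by
    intro w hw
    obtain ⟨n, P, hP, hb⟩ := Bar.exists_springs w
    rw [← hP]
    refine hm n P fun x => ?_
    rw [hb, hw, hG, Finsupp.finsetSum_apply]
    exact Finset.sum_congr rfl fun i _ => by rw [Finsupp.single_apply]
  -- Forces in equilibrium are carried by some finite system: a functional that kills all bar forces
  -- is a field of zero strain, hence kills `G`.
  have hres : ∃ w₀, Bar.boundary w₀ = G := by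
    by_contra! hne
    have hG' : G ∉ LinearMap.range Bar.boundary := by rintro ⟨w, hw⟩; exact hne w hw
    obtain ⟨L, hLG, hL⟩ := Submodule.exists_le_ker_of_notMem hG'
    refine hLG ?_
    rw [hGL]
    refine hF.sum_inner_eq_zero fun x y => ?_
    by_cases hxy : y = x
    · simp [hxy]
    have := inner_fieldOf_sub L ⟨(y, x), hxy⟩
    rw [this]
    have h0 : L (Bar.force ⟨(y, x), hxy⟩) = 0 :=
      hL ⟨Finsupp.single ⟨(y, x), hxy⟩ 1, by simp [Bar.boundary]⟩
    rw [h0, mul_zero]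
  by_cases hG0 : G = 0
  · refine ⟨0, fun x y => by simp, ?_⟩
    have := hw 0 (by rw [map_zero, hG0])
    simpa [Bar.weight] using this
  obtain ⟨g, hg⟩ : ∃ g : (Plane →₀ Plane) →ₗ[ℝ] ℝ, g G = m := by
    obtain ⟨g, hg⟩ := Submodule.exists_le_ker_of_notMem (K := ℝ) (p := ⊥) (v := G)
      (by simpa using hG0)
    refine ⟨(m / g G) • g, ?_⟩
    rw [LinearMap.smul_apply, smul_eq_mul, div_mul_cancel₀ _ hg.1]
  obtain ⟨w₀, hw₀⟩ := hres
  -- The extension starts from the combinations whose boundary is a multiple of `G`; there the bound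
  -- by `Bar.weight` is the lower bound `m` on masses, rescaled. This domain contains the kernel of
  -- `Bar.boundary`, so `g'` factors through the boundary map.
  obtain ⟨g', hg', hle⟩ := exists_extension_of_le_sublinear
    ⟨(Submodule.span ℝ {G}).comap Bar.boundary, (g ∘ₗ Bar.boundary).domRestrict _⟩ Bar.weight
    (fun c hc x => by rw [Bar.weight_smul, abs_of_pos hc]) Bar.weight_add (by
      rintro ⟨w, hws⟩
      obtain ⟨a, ha⟩ := Submodule.mem_span_singleton.1 hws
      change g (Bar.boundary w) ≤ Bar.weight w
      rw [← ha, map_smul, hg, smul_eq_mul]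
      rcases le_or_gt a 0 with h | h
      · exact (mul_nonpos_of_nonpos_of_nonneg h hm₀).trans (Bar.weight_nonneg w)
      · have := hw (a⁻¹ • w) (by rw [map_smul, ← ha, smul_smul, inv_mul_cancel₀ h.ne', one_smul])
        rw [Bar.weight_smul, abs_of_pos (inv_pos.2 h), ← div_eq_inv_mul, le_div_iff₀ h] at this
        linarith)
  have hker : g' ∈ LinearMap.range Bar.boundary.dualMap := by
    rw [LinearMap.range_dualMap_eq_dualAnnihilator_ker, Submodule.mem_dualAnnihilator]
    intro w hwk
    have hwk' : Bar.boundary w = 0 := hwk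
    have := hg' ⟨w, by simp [hwk']⟩
    rw [this]
    change g (Bar.boundary w) = 0
    rw [hwk', map_zero]
  obtain ⟨L, rfl⟩ := hker
  have hLle : ∀ w, L (Bar.boundary w) ≤ Bar.weight w := hle
  refine ⟨fieldOf L, fun x y => ?_, ?_⟩
  · by_cases hxy : y = x
    · simp [hxy]
    -- Domination by the weight on a single bar, with both signs, is exactly the strain bound
    -- between its endpoints.
    set b : Bar := ⟨(y, x), hxy⟩ with hb
    have h₁ := hLle (Finsupp.single b 1)
    have h₂ := hLle (Finsupp.single b (-1))
    have := inner_fieldOf_sub L b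
    rw [Bar.weight_single, Bar.boundary, Finsupp.linearCombination_single] at h₁ h₂
    simp only [abs_neg, abs_one, one_mul, neg_smul, one_smul, map_neg] at h₁ h₂
    simp only [hb] at this
    rw [this, abs_mul, abs_norm, sq]
    gcongr
    rw [dist_comm, dist_eq_norm] at h₁ h₂
    exact abs_le.2 ⟨by simp only [hb] at h₂; linarith, h₁⟩
  · rw [← hGL, ← hw₀]
    have := hg' ⟨w₀, by simp [hw₀, Submodule.mem_span_singleton_self]⟩
    change L (Bar.boundary w₀) = g (Bar.boundary w₀) at this
    rw [this, hw₀, hg]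

end

/-! ### Smooth approximation of dual fields -/

theorem IsDualField.abs_inner_fderiv_le {E : Type*} [NormedAddCommGroup E] [InnerProductSpace ℝ E]
    {φ : E → E} (hφ : IsDualField φ) {x : E} (hd : DifferentiableAt ℝ φ x) (w : E) :
    |inner ℝ (fderiv ℝ φ x w) w| ≤ ‖w‖ ^ 2 := by
  have hline : HasDerivAt (fun t : ℝ => x + t • w) w 0 := by
    simpa using ((hasDerivAt_id (0 : ℝ)).smul_const w).const_add x
  have hcomp : HasDerivAt (fun t : ℝ => φ (x + t • w)) (fderiv ℝ φ x w) 0 := by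
    have : HasFDerivAt φ (fderiv ℝ φ x) (x + (0 : ℝ) • w) := by simpa using hd.hasFDerivAt
    exact this.comp_hasDerivAt 0 hline
  have hin : HasDerivAt (fun t : ℝ => inner ℝ (φ (x + t • w)) w) (inner ℝ (fderiv ℝ φ x w) w) 0 := by
    simpa using hcomp.inner ℝ (hasDerivAt_const (0 : ℝ) w)
  refine hin.le_of_lip' (by positivity) (Filter.Eventually.of_forall fun t => ?_)
  have h := hφ (x + t • w) x
  rw [add_sub_cancel_left, inner_smul_right, norm_smul, abs_mul, mul_pow, Real.norm_eq_abs,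
    inner_sub_left] at h
  simp only [zero_smul, add_zero, sub_zero, Real.norm_eq_abs]
  rcases eq_or_ne t 0 with rfl | ht
  · simp
  · have : 0 < |t| := abs_pos.2 ht
    nlinarith

open ContinuousLinearMap in
-- The strain condition is convex in `φ` and invariant under translation, so averages of translates
-- keep it.
theorem IsDualField.mollify {φ : Plane → Plane} (hφ : IsDualField φ)
    (η : ContDiffBump (0 : Plane)) : IsDualField (convolution (η.normed volume) φ (lsmul ℝ ℝ)) := by
  intro x y
  have hint : ∀ z, Integrable (fun t => η.normed volume t • φ (z - t)) := fun z =>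
    (η.continuous_normed.smul (hφ.continuous.comp (by fun_prop))).integrable_of_hasCompactSupport
      η.hasCompactSupport_normed.smul_right
  have hsub : Integrable fun t => η.normed volume t • (φ (x - t) - φ (y - t)) := by
    simp only [smul_sub]
    exact (hint x).sub (hint y)
  have e : convolution (η.normed volume) φ (lsmul ℝ ℝ) volume x
      - convolution (η.normed volume) φ (lsmul ℝ ℝ) volume y
      = ∫ t, η.normed volume t • (φ (x - t) - φ (y - t)) := by
    simp only [convolution_def, lsmul_apply]
    rw [← integral_sub (hint x) (hint y)]
    simp only [smul_sub]
  rw [e, real_inner_comm, ← integral_inner hsub, ← Real.norm_eq_abs]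
  have hη : Integrable fun t => η.normed volume t * ‖x - y‖ ^ 2 := η.integrable_normed.mul_const _
  refine (norm_integral_le_of_norm_le hη (Filter.Eventually.of_forall fun t => ?_)).trans ?_
  · rw [inner_smul_right, norm_mul, Real.norm_of_nonneg (η.nonneg_normed t), real_inner_comm]
    have := hφ (x - t) (y - t)
    rw [sub_sub_sub_cancel_right] at this
    exact mul_le_mul_of_nonneg_left this (η.nonneg_normed t)
  · rw [integral_mul_const, η.integral_normed, one_mul]

/-- Dual fields are locally approximated by smooth ones. -/
theorem IsDualField.exists_smooth {φ : Plane → Plane} (hφ : IsDualField φ) (ρ : ℝ) {ε : ℝ}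
    (hε : 0 < ε) : ∃ ψ : Plane → Plane, ContDiff ℝ ∞ ψ ∧ HasCompactSupport ψ ∧
      (∀ x, ‖x‖ ≤ ρ → ∀ w, |inner ℝ (fderiv ℝ ψ x w) w| ≤ ‖w‖ ^ 2) ∧
      ∀ x, ‖x‖ ≤ ρ → ‖ψ x - φ x‖ ≤ ε := by
  obtain ⟨δ, hδ, huc⟩ := Metric.uniformContinuousOn_iff.1
    ((isCompact_closedBall (0 : Plane) (ρ + 1)).uniformContinuousOn_of_continuous
      hφ.continuous.continuousOn) ε hε
  have hr : 0 < min δ 1 := lt_min hδ one_pos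
  let η : ContDiffBump (0 : Plane) := ⟨min δ 1 / 2, min δ 1, half_pos hr, half_lt_self hr⟩
  let ψ₀ : Plane → Plane := MeasureTheory.convolution (η.normed volume) φ
    (ContinuousLinearMap.lsmul ℝ ℝ)
  have hψ₀ : IsDualField ψ₀ := hφ.mollify η
  have hsm : ContDiff ℝ ∞ ψ₀ := η.hasCompactSupport_normed.contDiff_convolution_left _
    η.contDiff_normed hφ.continuous.locallyIntegrable
  let χ : ContDiffBump (0 : Plane) :=
    ⟨|ρ| + 1, |ρ| + 2, by positivity, by linarith⟩
  have hone : ∀ x, ‖x‖ ≤ |ρ| + 1 → χ x • ψ₀ x = ψ₀ x := by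
    intro x hx
    rw [χ.one_of_mem_closedBall (by simpa using hx), one_smul]
  refine ⟨fun x => χ x • ψ₀ x, χ.contDiff.smul hsm, χ.hasCompactSupport.smul_right,
    fun x hx w => ?_, fun x hx => ?_⟩
  · have hev : (fun x => χ x • ψ₀ x) =ᶠ[nhds x] ψ₀ := by
      have hx' : x ∈ Metric.ball (0 : Plane) (|ρ| + 1) := by
        rw [mem_ball_zero_iff]; linarith [le_abs_self ρ]
      filter_upwards [Metric.isOpen_ball.mem_nhds hx'] with y hy
      exact hone y (mem_ball_zero_iff.1 hy).le
    rw [hev.fderiv_eq]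
    exact hψ₀.abs_inner_fderiv_le (hsm.differentiable (by simp) x) w
  · simp only
    rw [hone x (by linarith [le_abs_self ρ]), ← dist_eq_norm]
    refine η.dist_normed_convolution_le hφ.continuous.aestronglyMeasurable fun y hy => ?_
    have hy' : dist y x < min δ 1 := hy
    refine (huc y ?_ x ?_ (hy'.trans_le (min_le_left _ _))).le
    · rw [mem_closedBall_zero_iff]
      have h1 := hy'.trans_le (min_le_right _ _)
      rw [dist_eq_norm] at h1
      have := norm_add_le (y - x) x
      rw [sub_add_cancel] at this
      linarith
    · rw [mem_closedBall_zero_iff]; linarith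

/-! ### The cost of a matrix and its pairing with a strain -/

theorem abs_add_abs_eq_max (a b : ℝ) : |a| + |b| = max |a + b| |a - b| := by
  grind

/-- Sum and difference of the eigenvalues come from trace and determinant. The explicit form gives
measurability of the cost and its bound below by the trace. -/
theorem matrixCost_eq {A : Matrix (Fin 2) (Fin 2) ℝ} (hA : A.IsHermitian) :
    matrixCost hA = max |A 0 0 + A 1 1| (Real.sqrt ((A 0 0 - A 1 1) ^ 2 + 4 * (A 0 1 * A 1 0))) := by
  have ht := hA.trace_eq_sum_eigenvalues
  have hd := hA.det_eq_prod_eigenvalues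
  rw [Matrix.trace_fin_two, Fin.sum_univ_two] at ht
  rw [Matrix.det_fin_two, Fin.prod_univ_two] at hd
  simp only [RCLike.ofReal_real_eq_id, id_eq] at ht hd
  rw [matrixCost, Fin.sum_univ_two, abs_add_abs_eq_max, ht, ← Real.sqrt_sq_eq_abs (_ - _)]
  congr 2
  linear_combination 4 * hd + (A 0 0 + A 1 1 + hA.eigenvalues 0 + hA.eigenvalues 1) * (-1) * ht

theorem abs_trace_le_matrixCost {A : Matrix (Fin 2) (Fin 2) ℝ} (hA : A.IsHermitian) :
    |A 0 0 + A 1 1| ≤ matrixCost hA := by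
  rw [matrixCost_eq]
  exact le_max_left _ _

theorem matrixCost_nonneg {A : Matrix (Fin 2) (Fin 2) ℝ} (hA : A.IsHermitian) :
    0 ≤ matrixCost hA := Finset.sum_nonneg fun _ _ => abs_nonneg _

theorem matrixCost_le {A : Matrix (Fin 2) (Fin 2) ℝ} (hA : A.IsHermitian) :
    matrixCost hA ≤ |A 0 0| + |A 1 1| + 2 * |A 0 1| := by
  have hs : A 1 0 = A 0 1 := by simpa using hA.apply 0 1
  have h₁ := abs_sub (A 0 0) (A 1 1)
  rw [matrixCost_eq, hs]
  refine max_le ((abs_add_le _ _).trans (by linarith [abs_nonneg (A 0 1)]))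
    (Real.sqrt_le_iff.2 ⟨by positivity, ?_⟩)
  nlinarith [abs_nonneg (A 0 0), abs_nonneg (A 1 1), abs_nonneg (A 0 1), sq_abs (A 0 1),
    sq_abs (A 0 0), sq_abs (A 1 1), abs_mul_abs_self (A 0 0), neg_abs_le (A 0 0 * A 1 1),
    abs_mul (A 0 0) (A 1 1), mul_nonneg (abs_nonneg (A 0 0)) (abs_nonneg (A 0 1)),
    mul_nonneg (abs_nonneg (A 1 1)) (abs_nonneg (A 0 1))]

/-- The pairing of a matrix with a linear map. -/
noncomputable def pairing (A : Matrix (Fin 2) (Fin 2) ℝ) (B : Plane →L[ℝ] Plane) : ℝ :=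
  ∑ i, ∑ j, A i j * (B (EuclideanSpace.single j 1)) i

theorem sum_mul_mul_eq_inner (B : Plane →L[ℝ] Plane) (v : Plane) :
    ∑ i, ∑ j, v i * v j * (B (EuclideanSpace.single j 1)) i = inner ℝ (B v) v := by
  have hv : v = v 0 • EuclideanSpace.single 0 1 + v 1 • EuclideanSpace.single 1 1 := by
    ext i; fin_cases i <;> simp
  conv_rhs => rw [hv]
  simp only [PiLp.inner_apply, Fin.sum_univ_two, RCLike.inner_apply, RCLike.conj_to_real, map_add,
    map_smul]
  simp
  ring

/-- In an orthonormal eigenbasis of `A` the pairing only sees the values `⟪B v, v⟫` on eigenvectors,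
each at most `1` in absolute value. -/
theorem pairing_le_matrixCost {A : Matrix (Fin 2) (Fin 2) ℝ} (hA : A.IsHermitian)
    {B : Plane →L[ℝ] Plane} (hB : ∀ w, |inner ℝ (B w) w| ≤ ‖w‖ ^ 2) :
    pairing A B ≤ matrixCost hA := by
  have hent : ∀ i j, A i j
      = ∑ k, hA.eigenvalues k * (hA.eigenvectorBasis k i * hA.eigenvectorBasis k j) := by
    intro i j
    conv_lhs => rw [hA.spectral_theorem]
    simp [Unitary.conjStarAlgAut_apply, Matrix.mul_apply, Matrix.star_eq_conjTranspose,
      Matrix.diagonal_apply, Matrix.IsHermitian.eigenvectorUnitary_apply]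
    ring
  have : pairing A B
      = ∑ k, hA.eigenvalues k * inner ℝ (B (hA.eigenvectorBasis k)) (hA.eigenvectorBasis k) := by
    simp only [pairing, ← sum_mul_mul_eq_inner, hent, Fin.sum_univ_two]
    ring
  rw [this, matrixCost]
  refine Finset.sum_le_sum fun k _ => ?_
  have h := hB (hA.eigenvectorBasis k)
  rw [hA.eigenvectorBasis.orthonormal.1 k, one_pow] at h
  refine (le_abs_self _).trans ?_
  rw [abs_mul]
  exact mul_le_of_le_one_right (abs_nonneg _) h

/-! ### Integration against the stress of springs -/

/-- Integration of bounded functions against two representations of one signed measure. -/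
theorem integral_mul_eq_sum {α κ : Type*} [MeasurableSpace α] [Fintype κ] {μ : Measure α}
    {f : α → ℝ} (hf : Integrable f μ) (ν : κ → Measure α) [∀ k, IsFiniteMeasure (ν k)] (c : κ → ℝ)
    (h : ∀ E, MeasurableSet E → ∫ x in E, f x ∂μ = ∑ k, c k * (ν k E).toReal)
    {g : α → ℝ} (hg : Measurable g) {C : ℝ} (hC : ∀ x, ‖g x‖ ≤ C) :
    ∫ x, f x * g x ∂μ = ∑ k, c k * ∫ x, g x ∂ν k := by
  set m₁ := μ.withDensity fun x => ENNReal.ofReal (f x) with hm₁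
  set m₂ := μ.withDensity fun x => ENNReal.ofReal (-f x) with hm₂
  have : IsFiniteMeasure m₁ := isFiniteMeasure_withDensity_ofReal hf.2
  have : IsFiniteMeasure m₂ := isFiniteMeasure_withDensity_ofReal hf.neg.2
  set n₁ : Measure α := ∑ k, ENNReal.ofReal (-c k) • ν k with hn₁
  set n₂ : Measure α := ∑ k, ENNReal.ofReal (c k) • ν k with hn₂
  have hfin : ∀ k (r : ℝ), IsFiniteMeasure (ENNReal.ofReal r • ν k) := fun k r =>
    Measure.smul_finite _ ENNReal.ofReal_ne_top
  have : IsFiniteMeasure n₁ := by rw [hn₁]; infer_instance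
  have : IsFiniteMeasure n₂ := by rw [hn₂]; infer_instance
  have hint : ∀ (m : Measure α) [IsFiniteMeasure m], Integrable g m := fun m _ =>
    Integrable.of_bound hg.aestronglyMeasurable C (Filter.Eventually.of_forall hC)
  have hsum : ∀ (a : κ → ℝ) (E : Set α), ((∑ k, ENNReal.ofReal (a k) • ν k) E).toReal
      = ∑ k, max (a k) 0 * (ν k E).toReal := by
    intro a E
    rw [Measure.finsetSum_apply, ENNReal.toReal_sum fun k _ => measure_ne_top _ _]
    refine Finset.sum_congr rfl fun k _ => ?_
    rw [Measure.smul_apply, smul_eq_mul, ENNReal.toReal_mul, ENNReal.toReal_ofReal']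
  -- Moving negative parts to the other side turns an identity of signed measures into one of
  -- positive measures.
  have heq : m₁ + n₁ = m₂ + n₂ := by
    ext E hE
    rw [← ENNReal.toReal_eq_toReal_iff' (measure_ne_top _ _) (measure_ne_top _ _),
      Measure.add_apply, Measure.add_apply, ENNReal.toReal_add (measure_ne_top _ _)
      (measure_ne_top _ _), ENNReal.toReal_add (measure_ne_top _ _) (measure_ne_top _ _), hn₁, hn₂,
      hsum, hsum, hm₁, hm₂, withDensity_apply _ hE, withDensity_apply _ hE]
    have h₁ := integral_eq_lintegral_pos_part_sub_lintegral_neg_part (hf.integrableOn (s := E))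
    rw [h E hE] at h₁
    have h₂ : ∑ k, c k * (ν k E).toReal
        = ∑ k, max (c k) 0 * (ν k E).toReal - ∑ k, max (-c k) 0 * (ν k E).toReal := by
      rw [← Finset.sum_sub_distrib]
      refine Finset.sum_congr rfl fun k _ => ?_
      rw [← sub_mul, max_zero_sub_max_neg_zero_eq_self]
    linarith
  have hI : ∀ (a : κ → ℝ), ∫ x, g x ∂(∑ k, ENNReal.ofReal (a k) • ν k)
      = ∑ k, max (a k) 0 * ∫ x, g x ∂ν k := by
    intro a
    rw [integral_finsetSum_measure fun k _ => hint _]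
    refine Finset.sum_congr rfl fun k _ => ?_
    rw [integral_smul_measure, ENNReal.toReal_ofReal', smul_eq_mul]
  have hg₁ := congrArg (fun m => ∫ x, g x ∂m) heq
  rw [integral_add_measure (hint _) (hint _), integral_add_measure (hint _) (hint _), hn₁, hn₂, hI,
    hI, hm₁, hm₂, integral_withDensity_eq_integral_toReal_smul₀ hf.1.aemeasurable.ennreal_ofReal
    (Filter.Eventually.of_forall fun _ => ENNReal.ofReal_lt_top),
    integral_withDensity_eq_integral_toReal_smul₀ (f := fun x => ENNReal.ofReal (-f x))
      hf.neg.1.aemeasurable.ennreal_ofReal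
    (Filter.Eventually.of_forall fun _ => ENNReal.ofReal_lt_top)] at hg₁
  simp only [ENNReal.toReal_ofReal', smul_eq_mul] at hg₁
  have hb : ∀ F : α → ℝ, Integrable F μ → Integrable (fun x => F x * g x) μ := fun F hF =>
    hF.mul_bdd hg.aestronglyMeasurable (Filter.Eventually.of_forall hC)
  have hp : Integrable (fun x => max (f x) 0 * g x) μ := hb _ hf.pos_part
  have hn : Integrable (fun x => max (-f x) 0 * g x) μ := hb _ hf.neg_part
  have e₁ : ∫ x, f x * g x ∂μ = ∫ x, max (f x) 0 * g x ∂μ - ∫ x, max (-f x) 0 * g x ∂μ := by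
    rw [← integral_sub hp hn]
    refine integral_congr_ae (Filter.Eventually.of_forall fun x => ?_)
    simp only
    rw [← sub_mul, max_zero_sub_max_neg_zero_eq_self]
  have e₂ : ∑ k, c k * ∫ x, g x ∂ν k
      = ∑ k, max (c k) 0 * ∫ x, g x ∂ν k - ∑ k, max (-c k) 0 * ∫ x, g x ∂ν k := by
    rw [← Finset.sum_sub_distrib]
    refine Finset.sum_congr rfl fun k _ => ?_
    rw [← sub_mul, max_zero_sub_max_neg_zero_eq_self]
  linarith

/-- Length on a segment is the scaled image of length on the unit interval. -/
theorem hausdorffMeasure_restrict_segment (a d : Plane) :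
    (Measure.hausdorffMeasure 1 : Measure Plane).restrict (segment ℝ a (a + d))
      = ‖d‖₊ • (volume.restrict (Set.Icc (0 : ℝ) 1)).map fun t => a + t • d := by
  have hm : Measurable fun t : ℝ => a + t • d := by fun_prop
  have hf : ∀ t : ℝ, AffineMap.lineMap a (a + d) t = a + t • d := by
    intro t; simp [AffineMap.lineMap_apply, add_comm]
  ext E hE
  rw [Measure.restrict_apply hE, Measure.smul_apply, Measure.map_apply hm hE,
    Measure.restrict_apply (hm hE)]
  have : E ∩ segment ℝ a (a + d)
      = AffineMap.lineMap a (a + d) '' ((fun t : ℝ => a + t • d) ⁻¹' E ∩ Set.Icc 0 1) := by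
    rw [segment_eq_image_lineMap]
    ext x
    simp only [Set.mem_inter_iff, Set.mem_image, Set.mem_preimage, hf]
    constructor
    · rintro ⟨hx, t, ht, rfl⟩; exact ⟨t, ⟨hx, ht⟩, rfl⟩
    · rintro ⟨t, ⟨hx, ht⟩, rfl⟩; exact ⟨hx, t, ht, rfl⟩
  rw [this, hausdorffMeasure_lineMap_image, hausdorffMeasure_real]
  congr 1
  rw [nndist_eq_nnnorm]
  simp

theorem integral_segment_inner_fderiv {ψ : Plane → Plane} (hψ : ContDiff ℝ ∞ ψ) (a d : Plane) :
    ∫ x in segment ℝ a (a + d), inner ℝ (fderiv ℝ ψ x d) d ∂(Measure.hausdorffMeasure 1)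
      = ‖d‖ * inner ℝ (ψ (a + d) - ψ a) d := by
  have hc : Continuous fun x => inner ℝ (fderiv ℝ ψ x d) d :=
    ((hψ.continuous_fderiv (by simp)).clm_apply continuous_const).inner continuous_const
  have hl : Continuous fun t : ℝ => a + t • d := by fun_prop
  rw [hausdorffMeasure_restrict_segment, integral_smul_nnreal_measure,
    integral_map hl.measurable.aemeasurable hc.aestronglyMeasurable,
    integral_Icc_eq_integral_Ioc, ← intervalIntegral.integral_of_le zero_le_one]
  have hder : ∀ t ∈ Set.uIcc (0 : ℝ) 1, HasDerivAt (fun t : ℝ => inner ℝ (ψ (a + t • d)) d)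
      (inner ℝ (fderiv ℝ ψ (a + t • d) d) d) t := by
    intro t _
    have hline : HasDerivAt (fun t : ℝ => a + t • d) d t := by
      simpa using ((hasDerivAt_id t).smul_const d).const_add a
    have := ((hψ.differentiable (by simp) (a + t • d)).hasFDerivAt).comp_hasDerivAt t hline
    simpa using this.inner ℝ (hasDerivAt_const t d)
  rw [intervalIntegral.integral_eq_sub_of_hasDerivAt hder
    ((hc.comp hl).intervalIntegrable _ _)]
  simp [NNReal.smul_def, inner_sub_left]

/-! ### Rays of a spring at a point -/

namespace Spring

theorem length_pos (s : Spring) : 0 < ‖s.b - s.a‖ :=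
  norm_pos_iff.2 (sub_ne_zero.2 s.ne.symm)

theorem norm_dir (s : Spring) : ‖s.dir‖ = 1 := by
  rw [dir, norm_smul, norm_inv, norm_norm, inv_mul_cancel₀ s.length_pos.ne']

theorem measurableSet_carrier (s : Spring) : MeasurableSet s.carrier := by
  rw [carrier, ← convexHull_pair]
  exact ((Set.toFinite {s.a, s.b}).isCompact_convexHull (𝕜 := ℝ)).isClosed.measurableSet

theorem hausdorffMeasure_inter_carrier_lt_top (s : Spring) (S : Set Plane) :
    (Measure.hausdorffMeasure 1 : Measure Plane) (S ∩ s.carrier) < ⊤ := by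
  refine (measure_mono Set.inter_subset_right).trans_lt ?_
  rw [carrier, hausdorffMeasure_segment]
  exact edist_lt_top _ _

/-- `σ • s.dir`, with `σ = ±1`, points from `p` into the spring. -/
def PointsInto (s : Spring) (p : Plane) (σ : ℝ) : Prop := σ = 1 ∧ p ≠ s.b ∨ σ = -1 ∧ p ≠ s.a

theorem PointsInto.exists_mem_carrier {s : Spring} {p : Plane} {σ : ℝ} (h : s.PointsInto p σ)
    (hp : p ∈ s.carrier) : ∃ η > 0, ∀ t ∈ Set.Icc 0 η, p + (t * σ) • s.dir ∈ s.carrier := by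
  have hL := s.length_pos
  rw [carrier, segment_eq_image'] at hp ⊢
  obtain ⟨θ, ⟨hθ₀, hθ₁⟩, rfl⟩ := hp
  have key : ∀ t : ℝ, s.a + θ • (s.b - s.a) + t • s.dir
      = s.a + (θ + t / ‖s.b - s.a‖) • (s.b - s.a) := by
    intro t
    rw [add_smul, add_assoc]
    congr 2
    rw [dir, div_eq_mul_inv, mul_smul]
  simp only [PointsInto] at h
  rcases h with ⟨rfl, h⟩ | ⟨rfl, h⟩
  · have hθ : θ < 1 := lt_of_le_of_ne hθ₁ (by rintro rfl; exact h (by simp))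
    refine ⟨(1 - θ) * ‖s.b - s.a‖, by nlinarith, fun t ht => ⟨θ + t / ‖s.b - s.a‖, ⟨?_, ?_⟩, ?_⟩⟩
    · have := div_nonneg ht.1 hL.le
      linarith
    · have := (div_le_iff₀ hL).2 ht.2
      linarith
    · simp only [mul_one, key]
  · have hθ : 0 < θ := lt_of_le_of_ne hθ₀ (by rintro rfl; exact h (by simp))
    refine ⟨θ * ‖s.b - s.a‖, by nlinarith, fun t ht => ⟨θ - t / ‖s.b - s.a‖, ⟨?_, ?_⟩, ?_⟩⟩
    · have := (div_le_iff₀ hL).2 ht.2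
      linarith
    · have := div_nonneg ht.1 hL.le
      linarith
    · simp only [mul_neg, mul_one, key, neg_div, ← sub_eq_add_neg]

/-- The dichotomy between non-endpoints, with both orientations and no force, and endpoints, with an
inward orientation that fixes the sign of the force. -/
theorem boundaryForce_cases (s : Spring) (p : Plane) :
    (s.PointsInto p 1 ∧ s.PointsInto p (-1) ∧ s.boundaryForce p = 0) ∨
      ∃ σ, s.PointsInto p σ ∧ s.boundaryForce p = -(s.coeff * σ) • s.dir := by
  by_cases ha : p = s.a
  · right
    have hb : p ≠ s.b := ha ▸ s.ne
    exact ⟨1, Or.inl ⟨rfl, hb⟩, by rw [boundaryForce, if_neg hb, if_pos ha]; simp⟩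
  · by_cases hb : p = s.b
    · right
      exact ⟨-1, Or.inr ⟨rfl, ha⟩, by rw [boundaryForce, if_neg ha, if_pos hb]; simp⟩
    · left
      exact ⟨Or.inl ⟨rfl, hb⟩, Or.inr ⟨rfl, ha⟩, by simp [boundaryForce, ha, hb]⟩

end Spring

/-! ### Work and mass of a minimizer -/

namespace StressMeasure

theorem integrable_matrixCost (T : StressMeasure) :
    Integrable (fun x => matrixCost (T.symmetric x)) T.base := by
  have h := T.integrable
  refine Integrable.mono' (((h 0 0).abs.add (h 1 1).abs).add ((h 0 1).abs.const_mul 2)) ?_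
    (Filter.Eventually.of_forall fun x => ?_)
  · simp only [matrixCost_eq]
    have m := fun i j => (h i j).1.aemeasurable
    refine AEMeasurable.aestronglyMeasurable ?_
    exact (((m 0 0).add (m 1 1)).abs).max
      (((((m 0 0).sub (m 1 1)).pow_const 2).add (((m 0 1).mul (m 1 0)).const_mul 4)).sqrt)
  · rw [Real.norm_of_nonneg (matrixCost_nonneg _)]
    exact matrixCost_le _

theorem mass_nonneg (T : StressMeasure) : 0 ≤ T.mass :=
  integral_nonneg fun _ => matrixCost_nonneg _

theorem continuous_fderiv_entry {ψ : Plane → Plane} (hψ : ContDiff ℝ ∞ ψ) (i j : Fin 2) :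
    Continuous fun x => (fderiv ℝ ψ x (EuclideanSpace.single j 1)) i := by
  have := (hψ.continuous_fderiv (by simp)).clm_apply
    (continuous_const (y := (EuclideanSpace.single j 1 : Plane)))
  fun_prop

theorem exists_bound_fderiv_entry {ψ : Plane → Plane} (hψ : ContDiff ℝ ∞ ψ)
    (hc : HasCompactSupport ψ) (i j : Fin 2) :
    ∃ C, ∀ x, ‖(fderiv ℝ ψ x (EuclideanSpace.single j 1)) i‖ ≤ C :=
  ((hc.fderiv ℝ).comp_left (g := fun B : Plane →L[ℝ] Plane =>
    (B (EuclideanSpace.single j 1)) i) (by simp)).exists_bound_of_continuous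
    (continuous_fderiv_entry hψ i j)

theorem integrable_entry (T : StressMeasure) {ψ : Plane → Plane} (hψ : ContDiff ℝ ∞ ψ)
    (hc : HasCompactSupport ψ) (i j : Fin 2) :
    Integrable (fun x => T.density x i j * (fderiv ℝ ψ x (EuclideanSpace.single j 1)) i) T.base := by
  obtain ⟨C, hC⟩ := exists_bound_fderiv_entry hψ hc i j
  exact (T.integrable i j).mul_bdd (continuous_fderiv_entry hψ i j).aestronglyMeasurable
    (Filter.Eventually.of_forall hC)

theorem integrable_pairing (T : StressMeasure) {ψ : Plane → Plane} (hψ : ContDiff ℝ ∞ ψ)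
    (hc : HasCompactSupport ψ) :
    Integrable (fun x => pairing (T.density x) (fderiv ℝ ψ x)) T.base :=
  integrable_finsetSum _ fun i _ => integrable_finsetSum _ fun j _ => T.integrable_entry hψ hc i j

/-- `T` is in the set `U` the sum of the stresses of the springs `s k`. -/
def EqSpringsOn (T : StressMeasure) (U : Set Plane) {κ : Type*} [Fintype κ] (s : κ → Spring) :
    Prop :=
  ∀ S : Set Plane, MeasurableSet S → S ⊆ U →
    ∀ i j, ∫ x in S, T.density x i j ∂T.base = ∑ k, (s k).stressOn S i j

/-- Passes from sets to bounded test functions, entry by entry; the entries `u i * u j` then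
reassemble into the strain along each spring. -/
theorem EqSpringsOn.setIntegral_pairing {T : StressMeasure} {U : Set Plane} {κ : Type*} [Fintype κ]
    {s : κ → Spring} (h : T.EqSpringsOn U s) {S : Set Plane} (hS : MeasurableSet S) (hSU : S ⊆ U)
    {ψ : Plane → Plane} (hψ : ContDiff ℝ ∞ ψ) (hc : HasCompactSupport ψ) :
    ∫ x in S, pairing (T.density x) (fderiv ℝ ψ x) ∂T.base
      = ∑ k, (s k).coeff * ∫ x in S ∩ (s k).carrier,
          inner ℝ (fderiv ℝ ψ x (s k).dir) (s k).dir ∂(Measure.hausdorffMeasure 1) := by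
  have hfin : ∀ k, IsFiniteMeasure
      ((Measure.hausdorffMeasure 1 : Measure Plane).restrict (S ∩ (s k).carrier)) := fun k =>
    ⟨by rw [Measure.restrict_apply_univ]; exact (s k).hausdorffMeasure_inter_carrier_lt_top S⟩
  have entry : ∀ i j,
      ∫ x in S, T.density x i j * (fderiv ℝ ψ x (EuclideanSpace.single j 1)) i ∂T.base
      = ∑ k, (s k).coeff * (s k).dir i * (s k).dir j * ∫ x in S ∩ (s k).carrier,
          (fderiv ℝ ψ x (EuclideanSpace.single j 1)) i ∂(Measure.hausdorffMeasure 1) := by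
    intro i j
    obtain ⟨C, hC⟩ := exists_bound_fderiv_entry hψ hc i j
    refine integral_mul_eq_sum (T.integrable i j).integrableOn _ _ (fun E hE => ?_)
      (continuous_fderiv_entry hψ i j).measurable hC
    rw [Measure.restrict_restrict hE, h _ (hE.inter hS) (Set.inter_subset_right.trans hSU)]
    refine Finset.sum_congr rfl fun k _ => ?_
    rw [Spring.stressOn, Measure.restrict_apply hE, Set.inter_assoc]
  have line : ∀ k, ∫ x in S ∩ (s k).carrier,
      inner ℝ (fderiv ℝ ψ x (s k).dir) (s k).dir ∂(Measure.hausdorffMeasure 1)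
      = ∑ i, ∑ j, (s k).dir i * (s k).dir j * ∫ x in S ∩ (s k).carrier,
          (fderiv ℝ ψ x (EuclideanSpace.single j 1)) i ∂(Measure.hausdorffMeasure 1) := by
    intro k
    have hI : ∀ i j, Integrable (fun x => (s k).dir i * (s k).dir j *
        (fderiv ℝ ψ x (EuclideanSpace.single j 1)) i)
        ((Measure.hausdorffMeasure 1 : Measure Plane).restrict (S ∩ (s k).carrier)) := by
      intro i j
      obtain ⟨C, hC⟩ := exists_bound_fderiv_entry hψ hc i j
      exact (Integrable.of_bound (continuous_fderiv_entry hψ i j).aestronglyMeasurable C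
        (Filter.Eventually.of_forall hC)).const_mul _
    simp only [← sum_mul_mul_eq_inner]
    rw [integral_finsetSum _ fun i _ => integrable_finsetSum _ fun j _ => hI i j]
    refine Finset.sum_congr rfl fun i _ => ?_
    rw [integral_finsetSum _ fun j _ => hI i j]
    exact Finset.sum_congr rfl fun j _ => integral_const_mul _ _
  simp only [pairing]
  rw [integral_finsetSum _ fun i _ => integrable_finsetSum _ fun j _ =>
    (T.integrable_entry hψ hc i j).integrableOn]
  simp only [line, Finset.mul_sum]
  rw [Finset.sum_comm]
  refine Finset.sum_congr rfl fun i _ => ?_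
  rw [integral_finsetSum _ fun j _ => (T.integrable_entry hψ hc i j).integrableOn, Finset.sum_comm]
  refine Finset.sum_congr rfl fun j _ => ?_
  rw [entry]
  exact Finset.sum_congr rfl fun k _ => by ring

end StressMeasure

theorem le_of_forall_pos_le_add_mul {X Y D : ℝ} (h : ∀ ε > 0, X ≤ Y + ε * D) : X ≤ Y := by
  refine le_of_forall_pos_le_add fun δ hδ => ?_
  have hD : 0 < |D| + 1 := by positivity
  refine (h (δ / (|D| + 1)) (div_pos hδ hD)).trans ?_
  have h₁ : δ / (|D| + 1) * D ≤ δ / (|D| + 1) * (|D| + 1) :=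
    mul_le_mul_of_nonneg_left (by linarith [le_abs_self D]) (div_pos hδ hD).le
  rw [div_mul_cancel₀ _ hD.ne'] at h₁
  linarith

namespace StressMeasure

theorem BoundaryEq.integral_pairing {T : StressMeasure} {ι : Type*} [Fintype ι] {M F : ι → Plane}
    (h : T.BoundaryEq M F) {ψ : Plane → Plane} (hψ : ContDiff ℝ ∞ ψ) (hc : HasCompactSupport ψ) :
    ∫ x, pairing (T.density x) (fderiv ℝ ψ x) ∂T.base = ∑ k, inner ℝ (F k) (ψ (M k)) :=
  h ψ hψ hc

/-- On every piece of a minimizer, the work of a smooth approximation of an optimal dual field is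
almost the mass. -/
theorem setIntegral_cost_le {T : StressMeasure} {ι : Type*} [Fintype ι] {M F : ι → Plane}
    (hT : T.BoundaryEq M F) {φ : Plane → Plane}
    (hopt : T.mass ≤ ∑ i, inner ℝ (F i) (φ (M i))) {K : Set Plane} (hK : T.base Kᶜ = 0)
    {ψ : Plane → Plane} (hψ : ContDiff ℝ ∞ ψ) (hc : HasCompactSupport ψ)
    (hψK : ∀ x ∈ K, ∀ w, |inner ℝ (fderiv ℝ ψ x w) w| ≤ ‖w‖ ^ 2) {ε : ℝ}
    (hε : ∀ i, ‖ψ (M i) - φ (M i)‖ ≤ ε) {S : Set Plane} (hS : MeasurableSet S) :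
    ∫ x in S, matrixCost (T.symmetric x) ∂T.base
      ≤ ∫ x in S, pairing (T.density x) (fderiv ℝ ψ x) ∂T.base + ε * ∑ i, ‖F i‖ := by
  have hpi := T.integrable_pairing hψ hc
  have hci := T.integrable_matrixCost
  have h₁ := integral_add_compl hS hpi
  have h₂ := integral_add_compl hS hci
  have hae : ∀ᵐ x ∂T.base, x ∈ K := hK
  -- Work cannot exceed cost on the complement, so nearly all of the total near-equality must
  -- already hold on `S`.
  have h₃ : ∫ x in Sᶜ, pairing (T.density x) (fderiv ℝ ψ x) ∂T.base
      ≤ ∫ x in Sᶜ, matrixCost (T.symmetric x) ∂T.base :=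
    integral_mono_ae hpi.integrableOn hci.integrableOn (ae_restrict_of_ae (by
      filter_upwards [hae] with x hx
      exact pairing_le_matrixCost (T.symmetric x) (hψK x hx)))
  have h₄ : ∑ i, inner ℝ (F i) (φ (M i)) ≤ ∑ i, inner ℝ (F i) (ψ (M i)) + ε * ∑ i, ‖F i‖ := by
    rw [Finset.mul_sum, ← Finset.sum_add_distrib]
    refine Finset.sum_le_sum fun i _ => ?_
    have a := (abs_le.1 (abs_real_inner_le_norm (F i) (ψ (M i) - φ (M i)))).1
    rw [inner_sub_right] at a
    have b := mul_le_mul_of_nonneg_left (hε i) (norm_nonneg (F i))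
    linarith
  rw [hT.integral_pairing hψ hc] at h₁
  have h₅ : ∫ x, matrixCost (T.symmetric x) ∂T.base = T.mass := rfl
  linarith

/-- An optimal dual field has extremal strain along the springs of a minimizer. -/
theorem le_coeff_mul_inner {T : StressMeasure} {ι : Type*} [Fintype ι] {M F : ι → Plane}
    (hT : T.BoundaryEq M F) {φ : Plane → Plane} (hφ : IsDualField φ)
    (hopt : T.mass ≤ ∑ i, inner ℝ (F i) (φ (M i)))
    {κ : Type*} [Fintype κ] {s : κ → Spring} {U : Set Plane} (hloc : T.EqSpringsOn U s)
    {p : Plane} (hmeet : ∀ k l, k ≠ l → (s k).carrier ∩ (s l).carrier = {p})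
    (k : κ) {d : Plane} {c : ℝ} (hd : d = c • (s k).dir)
    (hdk : segment ℝ p (p + d) ⊆ (s k).carrier) (hdU : segment ℝ p (p + d) ⊆ U) :
    |(s k).coeff| * ‖d‖ ^ 2 ≤ (s k).coeff * inner ℝ (φ (p + d) - φ p) d := by
  have hcd : ‖d‖ ^ 2 = c ^ 2 := by
    rw [hd, norm_smul, (s k).norm_dir, mul_one, Real.norm_eq_abs, sq_abs]
  set S := segment ℝ p (p + d) with hSdef
  have hS : MeasurableSet S := by
    rw [hSdef, ← convexHull_pair]
    exact ((Set.toFinite {p, p + d}).isCompact_convexHull (𝕜 := ℝ)).isClosed.measurableSet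
  have hSk : S ∩ (s k).carrier = S := Set.inter_eq_left.2 hdk
  have hnull : ∀ l, l ≠ k →
      (Measure.hausdorffMeasure 1 : Measure Plane) (S ∩ (s l).carrier) = 0 := by
    intro l hl
    refine measure_mono_null (t := segment ℝ p p) ?_ (by rw [hausdorffMeasure_segment, edist_self])
    rw [segment_same, ← hmeet k l hl.symm]
    exact Set.inter_subset_inter_left _ hdk
  -- The trace is linear in the stress, so its integral can be read off from the springs; it bounds
  -- the cost from below, sharply because the stress of one spring has rank at most one.
  have htrace : ∫ x in S, (T.density x 0 0 + T.density x 1 1) ∂T.base = (s k).coeff * ‖d‖ := by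
    rw [integral_add (T.integrable 0 0).integrableOn (T.integrable 1 1).integrableOn,
      hloc S hS hdU, hloc S hS hdU, ← Finset.sum_add_distrib, Finset.sum_eq_single k]
    · have hn := (s k).norm_dir
      rw [EuclideanSpace.norm_eq, Real.sqrt_eq_one, Fin.sum_univ_two] at hn
      simp only [Real.norm_eq_abs, sq_abs] at hn
      simp only [Spring.stressOn]
      rw [hSk, hSdef, hausdorffMeasure_segment, edist_dist, ENNReal.toReal_ofReal dist_nonneg,
        dist_self_add_right]
      linear_combination (s k).coeff * ‖d‖ * hn
    · intro l _ hl
      simp only [Spring.stressOn, hnull l hl, ENNReal.toReal_zero, mul_zero, add_zero]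
    · exact fun h => absurd (Finset.mem_univ k) h
  have hcost : |(s k).coeff| * ‖d‖ ≤ ∫ x in S, matrixCost (T.symmetric x) ∂T.base := by
    have := norm_integral_le_of_norm_le (f := fun x => T.density x 0 0 + T.density x 1 1)
      (T.integrable_matrixCost.integrableOn (s := S))
      (Filter.Eventually.of_forall fun x => abs_trace_le_matrixCost (T.symmetric x))
    rwa [htrace, Real.norm_eq_abs, abs_mul, abs_norm] at this
  have hwork : ∀ ψ : Plane → Plane, ContDiff ℝ ∞ ψ → HasCompactSupport ψ →
      ‖d‖ ^ 2 * ∫ x in S, pairing (T.density x) (fderiv ℝ ψ x) ∂T.base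
        = ‖d‖ * ((s k).coeff * inner ℝ (ψ (p + d) - ψ p) d) := by
    intro ψ hψ hc
    rw [hloc.setIntegral_pairing hS hdU hψ hc, Finset.sum_eq_single k, hSk, mul_left_comm ‖d‖,
      ← integral_segment_inner_fderiv hψ, ← hSdef, hcd, mul_left_comm, ← integral_const_mul]
    · congr 2
      ext x
      rw [hd, map_smul, inner_smul_left, inner_smul_right, RCLike.conj_to_real]
      ring
    · intro l _ hl
      rw [Measure.restrict_eq_zero.2 (hnull l hl), integral_zero_measure, mul_zero]
    · exact fun h => absurd (Finset.mem_univ k) h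
  rcases (norm_nonneg d).eq_or_lt with h0 | hpos
  · rw [← h0, norm_eq_zero.1 h0.symm]; simp
  obtain ⟨K, hKc, hK⟩ := T.compactSupport
  -- The ball where the approximation must be good: the support of `T` for the strain, the `M i` for
  -- the work, `p` and `p + d` for the conclusion.
  obtain ⟨ρ, hρ⟩ := (hKc.union (((Set.finite_range M).union
    (Set.toFinite {p, p + d})).isCompact)).isBounded.exists_norm_le
  refine le_of_forall_pos_le_add_mul
    (D := ‖d‖ * ∑ i, ‖F i‖ + |(s k).coeff| * 2 * ‖d‖) fun ε hε => ?_
  obtain ⟨ψ, hψ, hc, hψe, hψa⟩ := hφ.exists_smooth ρ hε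
  have h₁ := setIntegral_cost_le hT hopt hK hψ hc (fun x hx => hψe x (hρ x (Or.inl hx)))
    (fun i => hψa _ (hρ _ (Or.inr (Or.inl ⟨i, rfl⟩)))) hS
  have h₂ := mul_le_mul_of_nonneg_left (hcost.trans h₁) (sq_nonneg ‖d‖)
  rw [mul_add, hwork ψ hψ hc] at h₂
  have h₃ : |(s k).coeff| * ‖d‖ ^ 2 ≤ (s k).coeff * inner ℝ (ψ (p + d) - ψ p) d
      + ‖d‖ * (ε * ∑ i, ‖F i‖) := by
    refine le_of_mul_le_mul_left ?_ hpos
    calc _ = ‖d‖ ^ 2 * (|(s k).coeff| * ‖d‖) := by ring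
      _ ≤ _ := h₂
      _ = _ := by ring
  have e₁ := hψa (p + d) (hρ _ (Or.inr (Or.inr (by simp))))
  have e₂ := hψa p (hρ _ (Or.inr (Or.inr (by simp))))
  have h₄ : (s k).coeff * inner ℝ (ψ (p + d) - ψ p) d
      ≤ (s k).coeff * inner ℝ (φ (p + d) - φ p) d + |(s k).coeff| * (2 * ε * ‖d‖) := by
    rw [← sub_le_iff_le_add', ← mul_sub, ← inner_sub_left]
    refine (le_abs_self _).trans ?_
    rw [abs_mul]
    refine mul_le_mul_of_nonneg_left ((abs_real_inner_le_norm _ _).trans ?_) (abs_nonneg _)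
    refine mul_le_mul_of_nonneg_right ?_ (norm_nonneg _)
    rw [sub_sub_sub_comm]
    exact (norm_sub_le _ _).trans (by linarith)
  linarith

/-- Near a point free of applied forces, the forces of the springs balance. -/
theorem sum_boundaryForce_eq_zero {T : StressMeasure} {ι : Type*} [Fintype ι] {M F : ι → Plane}
    (hT : T.BoundaryEq M F) {p : Plane} (hp : ∀ i, M i ≠ p) {κ : Type*} [Fintype κ]
    {s : κ → Spring} {r : ℝ} (hr : 0 < r) (hloc : T.EqSpringsOn (Metric.ball p r) s) :
    ∑ k, (s k).boundaryForce p = 0 := by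
  classical
  -- The bump must vanish at all loaded points and at all spring ends except `p`, so that only
  -- forces at `p` contribute. Pointing it along their sum `w` gives `⟪w, w⟫ = 0`.
  set Z : Set Plane := (Set.range M ∪ (Set.range (fun k => (s k).a) ∪ Set.range fun k => (s k).b))
    \ {p} with hZ
  have hZf : Z.Finite := ((Set.finite_range M).union
    ((Set.finite_range _).union (Set.finite_range _))).sdiff
  obtain ⟨δ, hδ, hδZ⟩ := Metric.isOpen_iff.1 hZf.isClosed.isOpen_compl p (by simp [hZ])
  have hm : 0 < min δ r := lt_min hδ hr
  let χ : ContDiffBump p := ⟨min δ r / 4, min δ r / 2, by linarith, by linarith⟩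
  have hχp : χ p = 1 := χ.one_of_mem_closedBall (by simp [χ.rIn_pos.le])
  have hχZ : ∀ z ∈ Z, χ z = 0 := by
    intro z hz
    refine χ.zero_of_le_dist ?_
    by_contra! hlt
    exact hδZ (Metric.mem_ball.2 (hlt.trans ((half_lt_self hm).trans_le (min_le_left _ _)))) hz
  set w := ∑ k, (s k).boundaryForce p with hw
  let ψ : Plane → Plane := fun x => χ x • w
  have hψ : ContDiff ℝ ∞ ψ := χ.contDiff.smul contDiff_const
  have hc : HasCompactSupport ψ := χ.hasCompactSupport.smul_right
  have hout : ∀ x ∉ Metric.ball p r, fderiv ℝ ψ x = 0 := by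
    intro x hx
    by_contra hne
    have h := tsupport_smul_subset_left χ (fun _ => w) (support_fderiv_subset ℝ hne)
    rw [χ.tsupport_eq] at h
    exact hx (Metric.closedBall_subset_ball ((half_lt_self hm).trans_le (min_le_right _ _)) h)
  have h₀ : ∫ x, pairing (T.density x) (fderiv ℝ ψ x) ∂T.base = 0 := by
    rw [hT.integral_pairing hψ hc]
    refine Finset.sum_eq_zero fun i _ => ?_
    rw [show ψ (M i) = χ (M i) • w from rfl, hχZ (M i) ⟨Or.inl ⟨i, rfl⟩, hp i⟩, zero_smul,
      inner_zero_right]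
  rw [← setIntegral_eq_integral_of_forall_compl_eq_zero (s := Metric.ball p r) (fun x hx => by
    simp [pairing, hout x hx]),
    hloc.setIntegral_pairing Metric.isOpen_ball.measurableSet subset_rfl hψ hc] at h₀
  have hk : ∀ k, (s k).coeff * ∫ x in Metric.ball p r ∩ (s k).carrier,
      inner ℝ (fderiv ℝ ψ x (s k).dir) (s k).dir ∂(Measure.hausdorffMeasure 1)
      = inner ℝ w ((s k).boundaryForce p) := by
    intro k
    have hL := (s k).length_pos
    have e₁ : ∫ x in Metric.ball p r ∩ (s k).carrier,
        inner ℝ (fderiv ℝ ψ x (s k).dir) (s k).dir ∂(Measure.hausdorffMeasure 1)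
        = ∫ x in (s k).carrier,
          inner ℝ (fderiv ℝ ψ x (s k).dir) (s k).dir ∂(Measure.hausdorffMeasure 1) :=
      (setIntegral_eq_of_subset_of_forall_sdiff_eq_zero (s k).measurableSet_carrier
        Set.inter_subset_right fun x hx => by
          rw [hout x fun hb => hx.2 ⟨hb, hx.1⟩]; simp).symm
    have e₂ := integral_segment_inner_fderiv hψ (s k).a ((s k).b - (s k).a)
    rw [add_sub_cancel] at e₂
    have e₃ : ∀ x, inner ℝ (fderiv ℝ ψ x (s k).dir) (s k).dir = (‖(s k).b - (s k).a‖⁻¹) ^ 2 *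
        inner ℝ (fderiv ℝ ψ x ((s k).b - (s k).a)) ((s k).b - (s k).a) := by
      intro x
      rw [Spring.dir, map_smul, inner_smul_left, inner_smul_right, RCLike.conj_to_real]
      ring
    have hχe : ∀ z, (z = (s k).a ∨ z = (s k).b) → χ z = if p = z then 1 else 0 := by
      intro z hz
      split_ifs with h
      · rw [← h, hχp]
      · refine hχZ z ⟨Or.inr ?_, fun h' => h h'.symm⟩
        rcases hz with rfl | rfl
        · exact Or.inl ⟨k, rfl⟩
        · exact Or.inr ⟨k, rfl⟩
    rw [e₁]
    simp only [e₃]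
    rw [integral_const_mul, Spring.carrier, e₂, Spring.boundaryForce,
      show ψ (s k).b = χ (s k).b • w from rfl, show ψ (s k).a = χ (s k).a • w from rfl,
      hχe _ (Or.inl rfl), hχe _ (Or.inr rfl), ← sub_smul, inner_smul_left, RCLike.conj_to_real]
    have e₄ : inner ℝ w (s k).dir
        = ‖(s k).b - (s k).a‖⁻¹ * inner ℝ w ((s k).b - (s k).a) := by
      rw [Spring.dir, inner_smul_right]
    have e₅ : ((if p = (s k).b then (s k).coeff • (s k).dir else 0)
        - if p = (s k).a then (s k).coeff • (s k).dir else 0)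
        = (((if p = (s k).b then 1 else 0) - if p = (s k).a then 1 else 0) * (s k).coeff)
          • (s k).dir := by
      split_ifs <;> simp
    rw [e₅, inner_smul_right, e₄]
    field_simp
  rw [Finset.sum_congr rfl fun k _ => hk k, ← inner_sum, ← hw] at h₀
  exact inner_self_eq_zero.1 h₀

end StressMeasure

/-! ### From no acute angles to right angles -/

namespace StressMeasure

/-- A compressed spring and a stretched spring issuing from one point of a minimizer do not meet at
an acute angle. -/
theorem mul_inner_dir_nonpos {T : StressMeasure} {ι : Type*} [Fintype ι] {M F : ι → Plane}
    (hT : T.BoundaryEq M F) {φ : Plane → Plane} (hφ : IsDualField φ)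
    (hopt : T.mass ≤ ∑ i, inner ℝ (F i) (φ (M i)))
    {κ : Type*} [Fintype κ] {s : κ → Spring} {p : Plane} {r : ℝ} (hr : 0 < r)
    (hloc : T.EqSpringsOn (Metric.ball p r) s) (hps : ∀ k, p ∈ (s k).carrier)
    (hmeet : ∀ k l, k ≠ l → (s k).carrier ∩ (s l).carrier = {p})
    {k l : κ} (hk : (s k).IsCompressed) (hl : (s l).IsStretched) {σ τ : ℝ}
    (hσ : (s k).PointsInto p σ) (hτ : (s l).PointsInto p τ) :
    σ * τ * inner ℝ (s k).dir (s l).dir ≤ 0 := by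
  have main : ∀ (m : κ) (ρ : ℝ), (s m).PointsInto p ρ → ∃ η > 0, ∀ t ∈ Set.Icc (0 : ℝ) 1,
      |(s m).coeff| * (t * ‖(η * ρ) • (s m).dir‖ ^ 2) ≤ (s m).coeff *
        inner ℝ (φ (p + t • (η * ρ) • (s m).dir) - φ p) ((η * ρ) • (s m).dir) := by
    intro m ρ hρ
    obtain ⟨η, hη, hηc⟩ := hρ.exists_mem_carrier (hps m)
    have hm : 0 < min η (r / 2) := lt_min hη (half_pos hr)
    refine ⟨min η (r / 2), hm, fun t ht => ?_⟩
    rcases ht.1.eq_or_lt with rfl | ht0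
    · simp
    set d := (min η (r / 2) * ρ) • (s m).dir with hd
    have hρ1 : |ρ| = 1 := by rcases hρ with ⟨rfl, _⟩ | ⟨rfl, _⟩ <;> simp
    have htd : t • d = ((t * min η (r / 2)) * ρ) • (s m).dir := by rw [hd, smul_smul, mul_assoc]
    have htm : t * min η (r / 2) ≤ min η (r / 2) := mul_le_of_le_one_left hm.le ht.2
    have h := le_coeff_mul_inner hT hφ hopt hloc hmeet m htd
      ((convex_segment _ _).segment_subset (hps m) (by
        rw [htd]; exact hηc _ ⟨by positivity, htm.trans (min_le_left _ _)⟩))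
      ((convex_ball p r).segment_subset (Metric.mem_ball_self hr) (by
        rw [mem_ball_iff_norm, add_sub_cancel_left, htd, norm_smul, (s m).norm_dir, mul_one,
          Real.norm_eq_abs, abs_mul, hρ1, mul_one, abs_of_pos (by positivity)]
        linarith [min_le_right η (r / 2)]))
    rw [norm_smul, mul_pow, Real.norm_eq_abs, sq_abs, inner_smul_right] at h
    refine le_of_mul_le_mul_left ?_ ht0
    calc _ = |(s m).coeff| * (t ^ 2 * ‖d‖ ^ 2) := by ring
      _ ≤ _ := h
      _ = _ := by ring
  have upper : ∀ (d : Plane), ∀ t ∈ Set.Icc (0 : ℝ) 1,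
      |inner ℝ (φ (p + t • d) - φ p) d| ≤ t * ‖d‖ ^ 2 := by
    intro d t ht
    rcases ht.1.eq_or_lt with rfl | ht0
    · simp
    have h := hφ (p + t • d) p
    rw [add_sub_cancel_left, inner_smul_right, abs_mul, abs_of_pos ht0, norm_smul, mul_pow,
      Real.norm_eq_abs, sq_abs] at h
    refine le_of_mul_le_mul_left ?_ ht0
    linarith
  obtain ⟨η, hη, h₁⟩ := main k σ hσ
  obtain ⟨θ, hθ, h₂⟩ := main l τ hτ
  have h := hφ.inner_nonpos (p := p) (d := (η * σ) • (s k).dir) (e := (θ * τ) • (s l).dir)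
    (fun t ht => le_antisymm (abs_le.1 (upper _ t ht)).2 (by
      have := h₁ t ht
      rw [abs_of_pos hk] at this
      exact le_of_mul_le_mul_left this hk))
    (fun t ht => le_antisymm (by
      have := h₂ t ht
      rw [abs_of_neg hl, neg_mul, ← mul_neg] at this
      by_contra! hc
      exact absurd (mul_lt_mul_of_neg_left hc hl) (not_lt.2 this)) (abs_le.1 (upper _ t ht)).1)
  rw [inner_smul_left, inner_smul_right, RCLike.conj_to_real] at h
  have hηθ : 0 < η * θ := mul_pos hη hθ
  by_contra! hc
  nlinarith [mul_pos hηθ hc]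

end StressMeasure

theorem mainTheorem7 {ι : Type*} [Fintype ι] (M F : ι → Plane) (hF : IsEquilibrium M F)
    (T : StressMeasure) (hT : T.IsMinimizer M F)
    (p : Plane) (hp : ∀ i, M i ≠ p)
    {κ : Type*} [Fintype κ] (s : κ → Spring) (hs : T.IsSpringsNear p s) :
    ∑ k, (s k).boundaryForce p = 0 ∧
      ∀ k l, (s k).IsStretched → (s l).IsCompressed →
        InnerProductGeometry.angle (s k).dir (s l).dir = Real.pi / 2 := by
  classical
  obtain ⟨hb, hmin⟩ := hT
  obtain ⟨hps, hmeet, r, hr, hloc⟩ := hs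
  have hbal := StressMeasure.sum_boundaryForce_eq_zero hb hp hr hloc
  refine ⟨hbal, fun l k hl hk => ?_⟩
  obtain ⟨φ, hφ, hopt⟩ := exists_dualField hF T.mass_nonneg hmin
  have key : ∀ {k l : κ}, (s k).IsCompressed → (s l).IsStretched → ∀ {σ τ : ℝ},
      (s k).PointsInto p σ → (s l).PointsInto p τ →
      σ * τ * inner ℝ (s k).dir (s l).dir ≤ 0 := fun hk hl _ _ hσ hτ =>
    StressMeasure.mul_inner_dir_nonpos hb hφ hopt hr hloc hps hmeet hk hl hσ hτ
  set f : κ → Plane := fun k => (s k).boundaryForce p with hf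
  -- The coefficients have opposite signs, so rays at a non-acute angle carry forces with
  -- nonnegative inner product.
  have hff : ∀ k l, (s k).IsCompressed → (s l).IsStretched → 0 ≤ inner ℝ (f k) (f l) := by
    intro k l hk hl
    rcases (s k).boundaryForce_cases p with ⟨_, _, h⟩ | ⟨σ, hσ, h⟩
    · simp [hf, h]
    rcases (s l).boundaryForce_cases p with ⟨_, _, h'⟩ | ⟨τ, hτ, h'⟩
    · simp [hf, h']
    have := key hk hl hσ hτ
    have hkl := mul_neg_of_pos_of_neg hk hl
    simp only [hf, h, h', inner_smul_left, inner_smul_right, RCLike.conj_to_real]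
    nlinarith [mul_nonneg_of_nonpos_of_nonpos hkl.le this]
  set A := Finset.univ.filter fun k => (s k).IsCompressed with hA
  set B := Finset.univ.filter fun k => (s k).IsStretched with hB
  have hAB : ∑ k ∈ A, f k = -∑ k ∈ B, f k := by
    rw [eq_neg_iff_add_eq_zero, hA, hB, Finset.sum_filter, Finset.sum_filter,
      ← Finset.sum_add_distrib]
    refine (Finset.sum_congr rfl fun k _ => ?_).trans hbal
    simp only [Spring.IsCompressed, Spring.IsStretched]
    rcases lt_trichotomy (s k).coeff 0 with h | h | h
    · simp [h, h.not_gt, hf]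
    · simp [h, hf, Spring.boundaryForce]
    · simp [h, h.not_gt, hf]
  -- By balance the double sum equals `-‖∑ l ∈ B, f l‖ ^ 2`, while all its terms are nonnegative.
  have hsum : ∑ k ∈ A, ∑ l ∈ B, inner ℝ (f k) (f l) = 0 := by
    refine le_antisymm ?_ (Finset.sum_nonneg fun k hk => Finset.sum_nonneg fun l hl =>
      hff k l (Finset.mem_filter.1 hk).2 (Finset.mem_filter.1 hl).2)
    simp only [← inner_sum, ← sum_inner]
    rw [hAB, inner_neg_left]
    exact neg_nonpos.2 real_inner_self_nonneg
  have hz : inner ℝ (f k) (f l) = 0 := by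
    have hkA : k ∈ A := Finset.mem_filter.2 ⟨Finset.mem_univ _, hk⟩
    have hlB : l ∈ B := Finset.mem_filter.2 ⟨Finset.mem_univ _, hl⟩
    have h := (Finset.sum_eq_zero_iff_of_nonneg (fun k hk => Finset.sum_nonneg fun l hl =>
      hff k l (Finset.mem_filter.1 hk).2 (Finset.mem_filter.1 hl).2)).1 hsum k hkA
    exact (Finset.sum_eq_zero_iff_of_nonneg fun l hl => hff k l hk (Finset.mem_filter.1 hl).2).1
      h l hlB
  rw [← InnerProductGeometry.inner_eq_zero_iff_angle_eq_pi_div_two, real_inner_comm]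
  have hsign : ∀ {m : κ}, ∃ σ, (s m).PointsInto p σ := by
    intro m
    rcases (s m).boundaryForce_cases p with ⟨h, _, _⟩ | ⟨σ, hσ, _⟩
    exacts [⟨1, h⟩, ⟨σ, hσ⟩]
  have hne : ∀ {m : κ} {σ : ℝ}, (s m).PointsInto p σ → σ ≠ 0 := by
    rintro m σ (⟨rfl, _⟩ | ⟨rfl, _⟩) <;> norm_num
  -- When `p` is interior to one spring its force at `p` is zero and `hz` says nothing; there the
  -- two opposite rays give both signs of the inequality.
  rcases (s k).boundaryForce_cases p with ⟨h₁, h₂, _⟩ | ⟨σ, hσ, h⟩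
  · obtain ⟨τ, hτ⟩ := hsign (m := l)
    have a := key hk hl h₁ hτ
    have b := key hk hl h₂ hτ
    have : τ * inner ℝ (s k).dir (s l).dir = 0 := by linarith
    exact (mul_eq_zero.1 this).resolve_left (hne hτ)
  rcases (s l).boundaryForce_cases p with ⟨h₁, h₂, _⟩ | ⟨τ, hτ, h'⟩
  · have a := key hk hl hσ h₁
    have b := key hk hl hσ h₂
    have : σ * inner ℝ (s k).dir (s l).dir = 0 := by linarith
    exact (mul_eq_zero.1 this).resolve_left (hne hσ)
  simp only [hf, h, h', inner_smul_left, inner_smul_right, RCLike.conj_to_real] at hz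
  have hk0 : (s k).coeff ≠ 0 := ne_of_gt hk
  have hl0 : (s l).coeff ≠ 0 := ne_of_lt hl
  simpa [hk0, hl0, hne hσ, hne hτ] using hz
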